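/- **Setting.** For each $n$, let $d=d_n\in\mathbb N$ (possibly larger than $n$), let $\mathcal X=\mathcal X_n$ be a measurable space, and let $\mathcal P_0=\mathcal P_{0,n}$ be a family of distributions $P$ of $(X,Y,Z)\in\mathcal X\times\mathbb R\times\mathbb R^{d}$ such that $Y=\gamma_P^\top Z+\varepsilon_P$ for some $\gamma_P\in\mathbb R^d$, where $\varepsilon_P$ is $P$-integrable and $\mathbb E_P(\varepsilon_P\mid X,Z)=0$. One observes two independent samples $\mathcal D_1=(X_i,Y_i,Z_i)_{i=1}^n$ and $\mathcal D_2=(X_i,Y_i,Z_i)_{i=n+1}^{2n}$ of i.i.d. observations from $P$. Let $\widehat f:\mathcal X\times\mathbb R^d\to\mathbb R$ be an arbitrary (measurable) function computed from $\mathcal D_2$. Using $\mathcal D_1$, regress $(Y_i)_{i\le n}$ on $(Z_i)_{i\le n}$ to obtain $\widehat m(z)=\widehat\gamma^\top z$, and regress $(\widehat f(X_i,Z_i))_{i\le n}$ on $(Z_i)_{i\le n}$ to obtain $\widehat m_{\widehat f}(z)=\widehat\eta^\top z$, where each regression is carried out by the Lasso or one of its variants or, more generally, by any measurable method that maps the $n$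 responses and $n$ covariate vectors to a coefficient vector; the methods may depend on $n$. All the procedures may in addition use a random seed that is independent of the data. Put $$u_{n,i}:=\widehat f(X_i,Z_i)-\widehat m_{\widehat f}(Z_i),\qquad \upsilon_{n,i}:=\frac{u_{n,i}}{\bigl(\sum_{k=1}^n u_{n,k}^2\bigr)^{1/2}},\qquad L_i:=\{Y_i-\widehat m(Z_i)\}\,u_{n,i},$$ $$T_{\mathrm{Lasso}}:=\frac{\frac1{\sqrt n}\sum_{i=1}^n L_i}{\sqrt{\frac1n\sum_{i=1}^n L_i^2-\bigl(\frac1n\sum_{i=1}^n L_i\bigr)^2}},$$ with the convention that a quotient with denominator $0$ is $0$. For random variables $R_{P,n}$ write $R_{P,n}=o_{\mathcal P_0}(1)$ if $\sup_{P\in\mathcal P_0}\mathbb P_P(|R_{P,n}|>\epsilon)\to0$ as $n\to\infty$ for every $\epsilon>0$. **Proposition.** Suppose that (a) there exist $\delta\in(0,2]$ and $c,C>0$, not depending on $n$, such that $\mathbb E_P(\varepsilon_P^2\mid X,Z)\ge c$ and $\mathbb E_P(|\varepsilon_P|^{2+\delta}\mid X,Z)\le C$ almost surely, for all $P\in\mathcal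 P_0$; (b) $\max_{i\le n}|\upsilon_{n,i}|=o_{\mathcal P_0}(1)$ and $\sum_{i=1}^n\upsilon_{n,i}^2=1+o_{\mathcal P_0}(1)$; (c) $\max_{i\le n}\|Z_i\|_\infty\cdot\|\widehat\gamma-\gamma_P\|_1=o_{\mathcal P_0}(1)$; (d) $\|\widehat\gamma-\gamma_P\|_1\cdot\bigl\|\sum_{i=1}^n Z_i\upsilon_{n,i}\bigr\|_\infty=o_{\mathcal P_0}(1)$. Then, with $\Phi$ the standard normal distribution function, $$\sup_{P\in\mathcal P_0}\ \sup_{t\in\mathbb R}\ \bigl|\mathbb P_P(T_{\mathrm{Lasso}}\le t)-\Phi(t)\bigr|\to0\qquad(n\to\infty).$$ -/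

import Mathlib

open MeasureTheory ProbabilityTheory Filter Topology
open scoped ENNReal

noncomputable section

/-- A single observation `(X, Y, Z)` with `X` in a measurable space, `Y` real and `Z` in `ℝ^d`. -/
abbrev Obs (𝒳 : Type*) (d : ℕ) : Type _ := 𝒳 × ℝ × (Fin d → ℝ)

/-- What a procedure sees: the sample `D₁`, the sample `D₂` (each of size `n`), and a random seed
carrying any additional randomness used by the algorithms. -/
abbrev Sample (n : ℕ) (𝒳 : Type*) (d : ℕ) (𝒮 : Type*) : Type _ :=
  (Fin n → Obs 𝒳 d) × (Fin n → Obs 𝒳 d) × 𝒮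

/-- The law of the data when observations have distribution `P`: all `2 n` observations are
independent with law `P`, and the seed has law `ρ` and is independent of them. -/
def sampleLaw (n : ℕ) {𝒳 : Type*} [MeasurableSpace 𝒳] {d : ℕ} {𝒮 : Type*} [MeasurableSpace 𝒮]
    (P : ProbabilityMeasure (Obs 𝒳 d)) (ρ : Measure 𝒮) : Measure (Sample n 𝒳 d 𝒮) :=
  (Measure.pi fun _ : Fin n => (P : Measure (Obs 𝒳 d))).prod
    ((Measure.pi fun _ : Fin n => (P : Measure (Obs 𝒳 d))).prod ρ)

/-- A (possibly randomised) method for fitting a linear function `z ↦ θᵀ z` to `n` responses and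
`n` covariate vectors in `ℝ^d`.  The Lasso, the square-root Lasso and their variants (with any
choice of the penalty level and weights from the regression data and the seed) are such methods. -/
structure LinearRegressionMethod (n d : ℕ) (𝒮 : Type*) [MeasurableSpace 𝒮] where
  /-- responses, covariates and seed are mapped to the fitted coefficient vector -/
  coef : (Fin n → ℝ) → (Fin n → Fin d → ℝ) → 𝒮 → (Fin d → ℝ)
  measurable_coef : Measurable
    fun q : (Fin n → ℝ) × (Fin n → Fin d → ℝ) × 𝒮 => coef q.1 q.2.1 q.2.2

/-- The ingredients of the single-split projected covariance measure with linear fits on `D₁`. -/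
structure PCM (n d : ℕ) (𝒳 𝒮 : Type*) [MeasurableSpace 𝒳] [MeasurableSpace 𝒮] where
  /-- the estimated projection computed from the sample `D₂` and the seed -/
  fhat : (Fin n → Obs 𝒳 d) → 𝒮 → 𝒳 × (Fin d → ℝ) → ℝ
  measurable_fhat : Measurable
    fun q : ((Fin n → Obs 𝒳 d) × 𝒮) × (𝒳 × (Fin d → ℝ)) => fhat q.1.1 q.1.2 q.2
  /-- the method used to regress `Y` on `Z` -/
  regY : LinearRegressionMethod n d 𝒮
  /-- the method used to regress `fhat (X, Z)` on `Z` -/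
  regF : LinearRegressionMethod n d 𝒮

namespace Sample

variable {n d : ℕ} {𝒳 𝒮 : Type*}

/-- `X_i` in the sample `D₁`. -/
def X (ω : Sample n 𝒳 d 𝒮) (i : Fin n) : 𝒳 := (ω.1 i).1

/-- `Y_i` in the sample `D₁`. -/
def Y (ω : Sample n 𝒳 d 𝒮) (i : Fin n) : ℝ := (ω.1 i).2.1

/-- `Z_i` in the sample `D₁`. -/
def Z (ω : Sample n 𝒳 d 𝒮) (i : Fin n) : Fin d → ℝ := (ω.1 i).2.2

end Sample

namespace PCM

variable {n d : ℕ} {𝒳 𝒮 : Type*} [MeasurableSpace 𝒳] [MeasurableSpace 𝒮]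

/-- The values of the estimated projection on `D₁`. -/
def fval (p : PCM n d 𝒳 𝒮) (ω : Sample n 𝒳 d 𝒮) (i : Fin n) : ℝ :=
  p.fhat ω.2.1 ω.2.2 (ω.X i, ω.Z i)

/-- Coefficient vector of the regression of `Y` on `Z` using `D₁`. -/
def gammaHat (p : PCM n d 𝒳 𝒮) (ω : Sample n 𝒳 d 𝒮) : Fin d → ℝ :=
  p.regY.coef ω.Y ω.Z ω.2.2

/-- Coefficient vector of the regression of the estimated projection on `Z` using `D₁`. -/
def etaHat (p : PCM n d 𝒳 𝒮) (ω : Sample n 𝒳 d 𝒮) : Fin d → ℝ :=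
  p.regF.coef (p.fval ω) ω.Z ω.2.2

/-- Residuals `u_i` of the regression of the estimated projection on `Z`. -/
def u (p : PCM n d 𝒳 𝒮) (ω : Sample n 𝒳 d 𝒮) (i : Fin n) : ℝ :=
  p.fval ω i - p.etaHat ω ⬝ᵥ ω.Z i

/-- Normalised residuals, with `0 / 0 = 0`. -/
def upsilon (p : PCM n d 𝒳 𝒮) (ω : Sample n 𝒳 d 𝒮) (i : Fin n) : ℝ :=
  p.u ω i / √(∑ k, p.u ω k ^ 2)

/-- The products of residuals `L_i`. -/
def L (p : PCM n d 𝒳 𝒮) (ω : Sample n 𝒳 d 𝒮) (i : Fin n) : ℝ :=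
  (ω.Y i - p.gammaHat ω ⬝ᵥ ω.Z i) * p.u ω i

/-- The test statistic: the normalised sum of the `L_i` divided by their empirical standard
deviation, with `0 / 0 = 0`. -/
def T (p : PCM n d 𝒳 𝒮) (ω : Sample n 𝒳 d 𝒮) : ℝ :=
  ((1 / √(n : ℝ)) * ∑ i, p.L ω i) /
    √((1 / (n : ℝ)) * (∑ i, p.L ω i ^ 2) - ((1 / (n : ℝ)) * ∑ i, p.L ω i) ^ 2)

end PCM

/-- The `ℓ₁` norm on `ℝ^d`.  (The norm `‖·‖` of Mathlib on `Fin d → ℝ` is the `ℓ_∞` norm.) -/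
def l1Norm {d : ℕ} (x : Fin d → ℝ) : ℝ := ∑ j, |x j|

/-- The error `ε = Y - γᵀ Z` as a function of the observation. -/
def noise {𝒳 : Type*} {d : ℕ} (γ : Fin d → ℝ) (w : Obs 𝒳 d) : ℝ := w.2.1 - γ ⬝ᵥ w.2.2

/-- The sigma-algebra generated by `(X, Z)`. -/
abbrev sigmaXZ (𝒳 : Type*) [MeasurableSpace 𝒳] (d : ℕ) : MeasurableSpace (Obs 𝒳 d) :=
  MeasurableSpace.comap (fun w : Obs 𝒳 d => (w.1, w.2.2)) inferInstance

/-- The null model: `Y = γᵀ Z + ε` with `ε` integrable and `E(ε | X, Z) = 0`. -/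
def NullLinearModel {𝒳 : Type*} [MeasurableSpace 𝒳] {d : ℕ} (P : Measure (Obs 𝒳 d))
    (γ : Fin d → ℝ) : Prop :=
  Integrable (noise γ) P ∧ P[noise γ | sigmaXZ 𝒳 d] =ᵐ[P] 0

/-- `E(ε² | X, Z) ≥ c` and `E(|ε|^(2+δ) | X, Z) ≤ C`, almost surely.  The bound on the conditional
moment includes that the moment itself is finite. -/
def NoiseMoments {𝒳 : Type*} [MeasurableSpace 𝒳] {d : ℕ} (P : Measure (Obs 𝒳 d))
    (γ : Fin d → ℝ) (δ c C : ℝ) : Prop :=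
  Integrable (fun w => |noise γ w| ^ (2 + δ)) P ∧
  (∀ᵐ w ∂P, c ≤ (P[fun w => noise γ w ^ 2 | sigmaXZ 𝒳 d]) w) ∧
  (∀ᵐ w ∂P, (P[fun w => |noise γ w| ^ (2 + δ) | sigmaXZ 𝒳 d]) w ≤ C)

/-- `R_{P,n} = o(1) uniformly`: for every `ε > 0`, the supremum over `P ∈ 𝒬 n` of the probability of
`|R_{P,n}| > ε` tends to `0`. -/
def UniformLittleO {I : ℕ → Type*} {Ω : ℕ → Type*} [∀ n, MeasurableSpace (Ω n)]
    (𝒬 : ∀ n, Set (I n)) (μ : ∀ n, I n → Measure (Ω n)) (R : ∀ n, I n → Ω n → ℝ) : Prop :=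
  ∀ ε : ℝ, 0 < ε →
    Tendsto (fun n => ⨆ P ∈ 𝒬 n, μ n P {ω | ε < |R n P ω|}) atTop (𝓝 0)

end

noncomputable section

/-! The normalised residuals `υ` are built from the covariates of the first sample, the second
sample and the seed, never from the responses `Y` of the first sample. Conditionally on this design
the `υ_i` are constants, while the errors are independent, centred, with variances at least `c` and
bounded `(2+δ)`-th moments. Put `V = ∑ υ_i² σ²(X_i, Z_i)`, where `σ²` is the conditional variance.
The oracle statistic `S = ∑ υ_i ε_i / √V` then obeys a Lyapunov central limit theorem as soon as the
weights are uniformly small.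

Two limit results carry the proof: `exists_forall_abs_measureReal_weighted_sum_le_sub_cdf_le` for
`S`, and `exists_forall_measureReal_weighted_sum_sq_le` for `∑ υ_i² (ε_i² - σ²(X_i, Z_i))`. Their
smallness threshold for the weights depends only on the moment constants and the tolerances. This is
the source of uniformity over `P`, the dimension and the spaces. `abs_sampleLaw_real_sub_le`
integrates such conditional bounds over the design, losing only the probability that the weights are
not negligible.

The statistic is invariant under rescaling of `u`, so `υ` may replace `u`. With `b_i = (γ̂ - γ)ᵀ
Z_i`, its numerator becomes `√V S - ∑ b_i υ_i` and its squared denominator is close to `V`. Since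
`γ̂` depends on `Y`, it is not fixed by the design; it enters only through `b`, and `ℓ₁`-`ℓ_∞`
duality bounds `max |b_i|` and `|∑ b_i υ_i|` by the quantities in conditions (c) and (d). The
deterministic inequality `abs_studentized_sub_le` combines these bounds, and
`abs_measureReal_le_sub_cdf_le` transfers the limit from `S` to the statistic because `Φ` is
Lipschitz. -/

/-! ### Taylor estimates for characteristic functions -/

/-- The remainder is quadratic near `0` and at most linear far away; a power between `1` and `2`
dominates both. The fractional power is needed because squared errors have only `1 + δ/2` moments.
-/
theorem norm_cexp_mul_I_sub_one_sub_le {p : ℝ} (hp1 : 1 ≤ p) (hp2 : p ≤ 2) (x : ℝ) :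
    ‖Complex.exp (x * Complex.I) - 1 - x * Complex.I‖ ≤ 3 * |x| ^ p := by
  have hn : ‖(x : ℂ) * Complex.I‖ = |x| := by simp
  rcases le_total |x| 1 with h | h
  · have h1 := Complex.norm_exp_sub_one_sub_id_le (x := (x : ℂ) * Complex.I) (by rwa [hn])
    rw [hn] at h1
    have h2 : |x| ^ 2 ≤ |x| ^ p := by
      rcases eq_or_lt_of_le (abs_nonneg x) with h0 | h0
      · rw [← h0, Real.zero_rpow (by linarith)]; norm_num
      · rw [← Real.rpow_natCast]
        exact Real.rpow_le_rpow_of_exponent_ge h0 h (by exact_mod_cast hp2)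
    have h3 : 0 ≤ |x| ^ p := by positivity
    linarith
  · have h2 : |x| ≤ |x| ^ p := by
      simpa using Real.rpow_le_rpow_of_exponent_le h hp1
    calc ‖Complex.exp (x * Complex.I) - 1 - x * Complex.I‖
        ≤ ‖Complex.exp (x * Complex.I)‖ + ‖(1 : ℂ)‖ + ‖(x : ℂ) * Complex.I‖ :=
          (norm_sub_le _ _).trans (by gcongr; exact norm_sub_le _ _)
      _ = 1 + 1 + |x| := by rw [hn, Complex.norm_exp_ofReal_mul_I, norm_one]
      _ ≤ 3 * |x| ^ p := by linarith

/-- Cubic near `0`, quadratic far away. The restriction `q ≤ 3` is what later forces `δ` to be cut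
down to `min δ 1`. -/
theorem norm_cexp_mul_I_sub_one_sub_add_le {q : ℝ} (hq2 : 2 ≤ q) (hq3 : q ≤ 3) (x : ℝ) :
    ‖Complex.exp (x * Complex.I) - 1 - x * Complex.I + x ^ 2 / 2‖ ≤ 4 * |x| ^ q := by
  have hn : ‖(x : ℂ) * Complex.I‖ = |x| := by simp
  rcases le_total |x| 1 with h | h
  · have h1 := Complex.exp_bound (x := (x : ℂ) * Complex.I) (by rwa [hn]) (n := 3) (by norm_num)
    rw [hn] at h1
    have h2 : |x| ^ 3 ≤ |x| ^ q := by
      rcases eq_or_lt_of_le (abs_nonneg x) with h0 | h0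
      · rw [← h0, Real.zero_rpow (by linarith)]; norm_num
      · rw [← Real.rpow_natCast]
        exact Real.rpow_le_rpow_of_exponent_ge h0 h (by exact_mod_cast hq3)
    have h3 : 0 ≤ |x| ^ q := by positivity
    have h4 : Complex.exp (x * Complex.I) -
        ∑ m ∈ Finset.range 3, ((x : ℂ) * Complex.I) ^ m / m.factorial =
        Complex.exp (x * Complex.I) - 1 - x * Complex.I + x ^ 2 / 2 := by
      simp [Finset.sum_range_succ, mul_pow]; ring
    rw [h4] at h1
    norm_num [Nat.factorial] at h1
    linarith
  · have h2 : |x| ^ 2 ≤ |x| ^ q := by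
      rw [← Real.rpow_natCast]
      exact Real.rpow_le_rpow_of_exponent_le h (by exact_mod_cast hq2)
    have h5 : ‖(x : ℂ) ^ 2 / 2‖ = |x| ^ 2 / 2 := by simp
    calc ‖Complex.exp (x * Complex.I) - 1 - x * Complex.I + x ^ 2 / 2‖
        ≤ ‖Complex.exp (x * Complex.I)‖ + ‖(1 : ℂ)‖ + ‖(x : ℂ) * Complex.I‖ + ‖(x : ℂ) ^ 2 / 2‖ :=
          (norm_add_le _ _).trans (by
            gcongr; exact (norm_sub_le _ _).trans (by gcongr; exact norm_sub_le _ _))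
      _ = 1 + 1 + |x| + |x| ^ 2 / 2 := by rw [hn, h5, Complex.norm_exp_ofReal_mul_I, norm_one]
      _ ≤ 4 * |x| ^ q := by nlinarith

/-- Factors are exchanged one at a time; those not being exchanged have modulus at most `1`. -/
theorem norm_prod_sub_prod_le {ι : Type*} (s : Finset ι) (a b : ι → ℂ)
    (ha : ∀ i, ‖a i‖ ≤ 1) (hb : ∀ i, ‖b i‖ ≤ 1) :
    ‖∏ i ∈ s, a i - ∏ i ∈ s, b i‖ ≤ ∑ i ∈ s, ‖a i - b i‖ := by
  classical
  induction s using Finset.induction_on with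
  | empty => simp
  | insert i s hi ih =>
    rw [Finset.prod_insert hi, Finset.prod_insert hi, Finset.sum_insert hi]
    have h : a i * ∏ j ∈ s, a j - b i * ∏ j ∈ s, b j =
        (a i - b i) * ∏ j ∈ s, a j + b i * (∏ j ∈ s, a j - ∏ j ∈ s, b j) := by ring
    have hP : ‖∏ j ∈ s, a j‖ ≤ 1 := by
      rw [norm_prod]; exact Finset.prod_le_one (fun _ _ => norm_nonneg _) fun j _ => ha j
    rw [h]
    refine (norm_add_le _ _).trans ?_
    rw [norm_mul, norm_mul]
    exact add_le_add (mul_le_of_le_one_right (norm_nonneg _) hP)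
      ((mul_le_of_le_one_left (norm_nonneg _) (hb i)).trans ih)

theorem charFun_map_sum_pi {ι : Type*} [Fintype ι] (ν : ι → Measure ℝ)
    [∀ i, IsProbabilityMeasure (ν i)] (g : ι → ℝ → ℝ) (hg : ∀ i, Measurable (g i)) (t : ℝ) :
    charFun ((Measure.pi ν).map fun x => ∑ i, g i (x i)) t =
      ∏ i, ∫ x, Complex.exp ((t * g i x : ℝ) * Complex.I) ∂ν i := by
  have hm : Measurable fun x : ι → ℝ => ∑ i, g i (x i) :=
    Finset.measurable_fun_sum _ fun i _ => (hg i).comp (measurable_pi_apply i)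
  rw [charFun_apply_real, integral_map hm.aemeasurable (by fun_prop),
    ← integral_fintype_prod_eq_prod]
  refine integral_congr_ae (ae_of_all _ fun x => ?_)
  simp only [← Complex.exp_sum]
  push_cast
  rw [Finset.mul_sum, Finset.sum_mul]

theorem integrable_cexp_mul_I {ν : Measure ℝ} [IsProbabilityMeasure ν] {g : ℝ → ℝ}
    (hg : Measurable g) (t : ℝ) :
    Integrable (fun x => Complex.exp ((t * g x : ℝ) * Complex.I)) ν := by
  refine Integrable.of_bound (C := 1) (by fun_prop) (ae_of_all _ fun x => ?_)
  rw [Complex.norm_exp_ofReal_mul_I]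

theorem norm_integral_cexp_mul_I_le_one {ν : Measure ℝ} [IsProbabilityMeasure ν] (g : ℝ → ℝ) :
    ‖∫ x, Complex.exp ((g x : ℝ) * Complex.I) ∂ν‖ ≤ 1 := by
  refine (norm_integral_le_integral_norm _).trans ?_
  simp only [Complex.norm_exp_ofReal_mul_I]
  simp

theorem norm_integral_cexp_sub_one_le {ν : Measure ℝ} [IsProbabilityMeasure ν] {g : ℝ → ℝ}
    (hg : Measurable g) {p : ℝ} (hp1 : 1 ≤ p) (hp2 : p ≤ 2) (hi : Integrable g ν)
    (h0 : ∫ x, g x ∂ν = 0) (hip : Integrable (fun x => |g x| ^ p) ν) (t : ℝ) :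
    ‖∫ x, Complex.exp ((t * g x : ℝ) * Complex.I) ∂ν - 1‖ ≤
      3 * |t| ^ p * ∫ x, |g x| ^ p ∂ν := by
  have hic : Integrable (fun x => ((t * g x : ℝ) : ℂ) * Complex.I) ν :=
    ((hi.const_mul t).ofReal (𝕜 := ℂ)).mul_const _
  have h1 : ∫ x, Complex.exp ((t * g x : ℝ) * Complex.I) ∂ν - 1 =
      ∫ x, (Complex.exp ((t * g x : ℝ) * Complex.I) - 1 - (t * g x : ℝ) * Complex.I) ∂ν := by
    have hi1 : Integrable (fun x => Complex.exp ((t * g x : ℝ) * Complex.I) - 1) ν :=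
      (integrable_cexp_mul_I hg t).sub (integrable_const _)
    rw [integral_sub hi1 hic,
      integral_sub (integrable_cexp_mul_I hg t) (integrable_const _), integral_mul_const,
      integral_complex_ofReal, integral_const_mul, h0]
    simp
  rw [h1, ← integral_const_mul]
  refine norm_integral_le_of_norm_le (hip.const_mul _) (ae_of_all _ fun x => ?_)
  refine (norm_cexp_mul_I_sub_one_sub_le hp1 hp2 _).trans_eq ?_
  rw [abs_mul, Real.mul_rpow (abs_nonneg _) (abs_nonneg _)]; ring

theorem norm_integral_cexp_sub_one_add_le {ν : Measure ℝ} [IsProbabilityMeasure ν] {g : ℝ → ℝ}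
    (hg : Measurable g) {q : ℝ} (hq2 : 2 ≤ q) (hq3 : q ≤ 3) (hi : Integrable g ν)
    (h0 : ∫ x, g x ∂ν = 0) (hi2 : Integrable (fun x => g x ^ 2) ν)
    (hiq : Integrable (fun x => |g x| ^ q) ν) (t : ℝ) :
    ‖∫ x, Complex.exp ((t * g x : ℝ) * Complex.I) ∂ν -
        (1 - (t ^ 2 * (∫ x, g x ^ 2 ∂ν) / 2 : ℝ))‖ ≤
      4 * |t| ^ q * ∫ x, |g x| ^ q ∂ν := by
  have hic : Integrable (fun x => ((t * g x : ℝ) : ℂ) * Complex.I) ν :=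
    ((hi.const_mul t).ofReal (𝕜 := ℂ)).mul_const _
  have hi2c : Integrable (fun x => (((t * g x) ^ 2 / 2 : ℝ) : ℂ)) ν := by
    simp only [mul_pow]
    exact (((hi2.const_mul (t ^ 2)).div_const 2).ofReal (𝕜 := ℂ))
  have h1 : ∫ x, Complex.exp ((t * g x : ℝ) * Complex.I) ∂ν -
        (1 - (t ^ 2 * (∫ x, g x ^ 2 ∂ν) / 2 : ℝ)) =
      ∫ x, (Complex.exp ((t * g x : ℝ) * Complex.I) - 1 - (t * g x : ℝ) * Complex.I +
        (((t * g x) ^ 2 / 2 : ℝ) : ℂ)) ∂ν := by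
    have hi1 : Integrable (fun x => Complex.exp ((t * g x : ℝ) * Complex.I) - 1) ν :=
      (integrable_cexp_mul_I hg t).sub (integrable_const _)
    have hi3 : Integrable (fun x => Complex.exp ((t * g x : ℝ) * Complex.I) - 1 -
        (t * g x : ℝ) * Complex.I) ν := hi1.sub hic
    rw [integral_add hi3 hi2c, integral_sub hi1 hic,
      integral_sub (integrable_cexp_mul_I hg t) (integrable_const _), integral_mul_const,
      integral_complex_ofReal, integral_const_mul, h0, integral_complex_ofReal, integral_div]
    simp only [mul_pow]
    rw [integral_const_mul]
    simp
    ring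
  rw [h1, ← integral_const_mul]
  refine norm_integral_le_of_norm_le (hiq.const_mul _) (ae_of_all _ fun x => ?_)
  have h2 := norm_cexp_mul_I_sub_one_sub_add_le hq2 hq3 (t * g x)
  rw [abs_mul, Real.mul_rpow (abs_nonneg _) (abs_nonneg _)] at h2
  refine (le_of_eq ?_).trans (h2.trans_eq (by ring))
  push_cast; rfl

theorem abs_exp_neg_sub_one_add_le {a : ℝ} (ha : 0 ≤ a) : |Real.exp (-a) - (1 - a)| ≤ a ^ 2 := by
  have h1 := Real.add_one_le_exp (-a)
  rw [abs_of_nonneg (by linarith)]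
  rcases le_total a 1 with h | h
  · have := Real.norm_exp_sub_one_sub_id_le (x := -a) (by rwa [norm_neg, Real.norm_of_nonneg ha])
    rw [Real.norm_eq_abs, norm_neg, Real.norm_eq_abs, sq_abs] at this
    have := le_abs_self (Real.exp (-a) - 1 - -a)
    linarith
  · have : Real.exp (-a) ≤ 1 := Real.exp_le_one_iff.2 (by linarith)
    nlinarith

/-! ### Error laws and the weighted central limit theorem -/

/-- A centred law on `ℝ` with variance at least `c` and absolute `(2+δ)`-th moment at most `C`. -/
structure IsErrorLaw (ν : Measure ℝ) (δ c C : ℝ) : Prop where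
  integrable : Integrable (fun x : ℝ => x) ν
  integral_eq_zero : ∫ x, x ∂ν = 0
  integrable_rpow : Integrable (fun x : ℝ => |x| ^ (2 + δ)) ν
  le_variance : c ≤ ∫ x, x ^ 2 ∂ν
  moment_le : ∫ x, |x| ^ (2 + δ) ∂ν ≤ C

theorem abs_rpow_le_one_add {a b : ℝ} (ha : 0 ≤ a) (hab : a ≤ b) (x : ℝ) :
    |x| ^ a ≤ 1 + |x| ^ b := by
  have h0 : 0 ≤ |x| ^ b := by positivity
  rcases le_total |x| 1 with h | h
  · have := Real.rpow_le_one (abs_nonneg x) h ha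
    linarith
  · have := Real.rpow_le_rpow_of_exponent_le h hab
    linarith

namespace IsErrorLaw

variable {ν : Measure ℝ} {δ c C : ℝ}

theorem sq_le (hδ : 0 ≤ δ) (x : ℝ) : x ^ 2 ≤ 1 + |x| ^ (2 + δ) := by
  have := abs_rpow_le_one_add (a := 2) (b := 2 + δ) (by norm_num) (by linarith) x
  rwa [show (2 : ℝ) = ((2 : ℕ) : ℝ) by norm_num, Real.rpow_natCast, sq_abs] at this

theorem integrable_sq [IsProbabilityMeasure ν] (h : IsErrorLaw ν δ c C) (hδ : 0 ≤ δ) :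
    Integrable (fun x : ℝ => x ^ 2) ν := by
  refine ((integrable_const 1).add h.integrable_rpow).mono' (by fun_prop) (ae_of_all _ fun x => ?_)
  rw [Real.norm_of_nonneg (sq_nonneg x)]
  exact sq_le hδ x

theorem variance_le [IsProbabilityMeasure ν] (h : IsErrorLaw ν δ c C) (hδ : 0 ≤ δ) :
    ∫ x, x ^ 2 ∂ν ≤ 1 + C := by
  calc ∫ x, x ^ 2 ∂ν ≤ ∫ x, (1 + |x| ^ (2 + δ)) ∂ν :=
        integral_mono (h.integrable_sq hδ) ((integrable_const 1).add h.integrable_rpow) (sq_le hδ)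
    _ = 1 + ∫ x, |x| ^ (2 + δ) ∂ν := by
        rw [integral_add (integrable_const 1) h.integrable_rpow]; simp
    _ ≤ 1 + C := by linarith [h.moment_le]

/-- Lets the central limit theorem work with an exponent at most `3`, at the price of a larger
moment bound. -/
theorem mono_exponent [IsProbabilityMeasure ν] (h : IsErrorLaw ν δ c C) {δ' : ℝ} (hδ' : 0 ≤ δ')
    (hδ : δ' ≤ δ) : IsErrorLaw ν δ' c (1 + C) := by
  have hb : ∀ x : ℝ, |x| ^ (2 + δ') ≤ 1 + |x| ^ (2 + δ) :=
    abs_rpow_le_one_add (by linarith) (by linarith)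
  have hi : Integrable (fun x : ℝ => |x| ^ (2 + δ')) ν := by
    refine ((integrable_const 1).add h.integrable_rpow).mono'
      (Measurable.aestronglyMeasurable (by fun_prop)) (ae_of_all _ fun x => ?_)
    rw [Real.norm_of_nonneg (by positivity)]
    exact hb x
  refine ⟨h.integrable, h.integral_eq_zero, hi, h.le_variance, ?_⟩
  calc ∫ x, |x| ^ (2 + δ') ∂ν ≤ ∫ x, (1 + |x| ^ (2 + δ)) ∂ν :=
        integral_mono hi ((integrable_const 1).add h.integrable_rpow) hb
    _ = 1 + ∫ x, |x| ^ (2 + δ) ∂ν := by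
        rw [integral_add (integrable_const 1) h.integrable_rpow]; simp
    _ ≤ 1 + C := by linarith [h.moment_le]

end IsErrorLaw

/-- The Lyapunov step: `δ` of the powers are spent on the maximum, the other two on the sum of
squares. -/
theorem sum_abs_rpow_le {ι : Type*} [Fintype ι] {w : ι → ℝ} {m δ : ℝ} (hδ : 0 ≤ δ)
    (hw : ∀ i, |w i| ≤ m) : ∑ i, |w i| ^ (2 + δ) ≤ m ^ δ * ∑ i, w i ^ 2 := by
  rw [Finset.mul_sum]
  refine Finset.sum_le_sum fun i _ => ?_
  rw [add_comm, Real.rpow_add_of_nonneg (abs_nonneg _) hδ (by norm_num)]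
  have : |w i| ^ (2 : ℝ) = w i ^ 2 := by
    rw [show (2 : ℝ) = ((2 : ℕ) : ℝ) by norm_num, Real.rpow_natCast, sq_abs]
  rw [this]
  gcongr
  exact hw i

/-- The Gaussian characteristic function splits as `∏ exp(-a_i)`, where `a_i` is the share of `t²/2`
due to the `i`-th variance. Each factor is compared with `1 - a_i`, from both sides; the errors add
up to a Lyapunov sum and `∑ a_i²`. -/
theorem norm_charFun_weighted_sum_sub_le {ι : Type*} [Fintype ι] {δ c C : ℝ} (hδ : 0 ≤ δ)
    (hδ1 : δ ≤ 1) (hc : 0 < c) (hC : 0 ≤ C) (ν : ι → Measure ℝ) [∀ i, IsProbabilityMeasure (ν i)]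
    (hν : ∀ i, IsErrorLaw (ν i) δ c C) {w : ι → ℝ} {m : ℝ} (hm : 0 ≤ m) (hw : ∀ i, |w i| ≤ m)
    (hvar : ∑ i, w i ^ 2 * ∫ x, x ^ 2 ∂ν i = 1) (t : ℝ) :
    ‖charFun ((Measure.pi ν).map fun x => ∑ i, w i * x i) t - Complex.exp (-(t ^ 2 / 2))‖ ≤
      4 * |t| ^ (2 + δ) * C * (m ^ δ * c⁻¹) + t ^ 4 / 4 * (m ^ 2 * (1 + C)) := by
  set s : ι → ℝ := fun i => ∫ x, x ^ 2 ∂ν i with hs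
  set a : ι → ℝ := fun i => t ^ 2 * (w i ^ 2 * s i) / 2 with ha
  have hs0 : ∀ i, 0 ≤ s i := fun i => hc.le.trans (hν i).le_variance
  have ha0 : ∀ i, 0 ≤ a i := fun i => by have := hs0 i; positivity
  have hsum : ∑ i, a i = t ^ 2 / 2 := by
    simp only [ha]
    rw [← Finset.sum_div, ← Finset.mul_sum, hvar, mul_one]
  have hw2 : ∑ i, w i ^ 2 ≤ c⁻¹ := by
    rw [← one_div, le_div_iff₀ hc, ← hvar, Finset.sum_mul]
    exact Finset.sum_le_sum fun i _ =>
      mul_le_mul_of_nonneg_left (hν i).le_variance (sq_nonneg _)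
  have hexp : Complex.exp (-(t ^ 2 / 2)) = ∏ i, ((Real.exp (-(a i)) : ℝ) : ℂ) := by
    rw [← Complex.ofReal_prod, ← Real.exp_sum, Finset.sum_neg_distrib, hsum]
    push_cast; rfl
  rw [charFun_map_sum_pi ν (fun i x => w i * x) (fun i => by fun_prop), hexp]
  refine (norm_prod_sub_prod_le _ _ _ (fun i => norm_integral_cexp_mul_I_le_one _)
    (fun i => ?_)).trans ?_
  · rw [Complex.norm_real, Real.norm_of_nonneg (Real.exp_pos _).le]
    exact Real.exp_le_one_iff.2 (by linarith [ha0 i])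
  have hterm : ∀ i, ‖∫ x, Complex.exp ((t * (w i * x) : ℝ) * Complex.I) ∂ν i -
      ((Real.exp (-(a i)) : ℝ) : ℂ)‖ ≤
      4 * |t| ^ (2 + δ) * C * |w i| ^ (2 + δ) + t ^ 2 / 2 * (m ^ 2 * (1 + C)) * a i := by
    intro i
    have h1 := norm_integral_cexp_sub_one_add_le (ν := ν i) (g := fun x => x) measurable_id
      (q := 2 + δ) (by linarith) (by linarith) (hν i).integrable (hν i).integral_eq_zero
      ((hν i).integrable_sq hδ) (hν i).integrable_rpow (t * w i)
    have h2 : ‖((1 - a i : ℝ) : ℂ) - ((Real.exp (-(a i)) : ℝ) : ℂ)‖ ≤ a i ^ 2 := by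
      rw [← Complex.ofReal_sub, Complex.norm_real, Real.norm_eq_abs, abs_sub_comm]
      exact abs_exp_neg_sub_one_add_le (ha0 i)
    -- A bound on each `a_i` that is uniform in `i` gives `∑ a_i² ≤ (max a_i) ∑ a_i`, which vanishes
    -- with `m`.
    have h3 : a i ≤ t ^ 2 / 2 * (m ^ 2 * (1 + C)) := by
      have : w i ^ 2 ≤ m ^ 2 := sq_le_sq' (by linarith [neg_abs_le (w i), hw i])
        ((le_abs_self _).trans (hw i))
      have h4 := (hν i).variance_le hδ
      calc a i = t ^ 2 / 2 * (w i ^ 2 * s i) := by simp only [ha]; ring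
        _ ≤ _ := by gcongr
    have h5 : ((1 - ((t * w i) ^ 2 * (∫ x, x ^ 2 ∂ν i) / 2 : ℝ)) : ℂ) = ((1 - a i : ℝ) : ℂ) := by
      simp only [ha, hs]; push_cast; ring
    have h6 : ∀ x : ℝ, t * (w i * x) = t * w i * x := fun x => by ring
    simp only [h6]
    rw [h5, abs_mul, Real.mul_rpow (abs_nonneg _) (abs_nonneg _)] at h1
    calc _ ≤ _ + _ := norm_sub_le_norm_sub_add_norm_sub _ ((1 - a i : ℝ) : ℂ) _
      _ ≤ 4 * (|t| ^ (2 + δ) * |w i| ^ (2 + δ)) * C + a i * a i := by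
        refine add_le_add (h1.trans ?_) (h2.trans_eq (sq _))
        gcongr
        exact (hν i).moment_le
      _ ≤ _ := by
        have := mul_le_mul_of_nonneg_right h3 (ha0 i)
        linarith
  refine (Finset.sum_le_sum fun i _ => hterm i).trans ?_
  rw [Finset.sum_add_distrib, ← Finset.mul_sum, ← Finset.mul_sum, hsum]
  have h7 : ∑ i, |w i| ^ (2 + δ) ≤ m ^ δ * c⁻¹ :=
    (sum_abs_rpow_le hδ hw).trans (by gcongr)
  refine add_le_add (by gcongr) (le_of_eq (by ring))

/-! ### Uniform convergence to the Gaussian distribution function -/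

theorem gaussianPDFReal_zero_one_le_one (x : ℝ) : gaussianPDFReal 0 1 x ≤ 1 := by
  rw [gaussianPDFReal_def]
  refine mul_le_one₀ (inv_le_one_of_one_le₀ ?_) (Real.exp_pos _).le (Real.exp_le_one_iff.2 ?_)
  · rw [Real.one_le_sqrt]
    have := Real.pi_gt_three
    norm_num; linarith
  · simp only [NNReal.coe_one]
    have := sq_nonneg (x - 0)
    rw [neg_div]
    have : 0 ≤ (x - 0) ^ 2 / (2 * 1) := by positivity
    linarith

theorem cdf_gaussianReal_add_le (t : ℝ) {r : ℝ} (hr : 0 ≤ r) :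
    cdf (gaussianReal 0 1) (t + r) ≤ cdf (gaussianReal 0 1) t + r := by
  rw [cdf_eq_real, cdf_eq_real]
  have h1 : Set.Iic (t + r) = Set.Iic t ∪ Set.Ioc t (t + r) :=
    (Set.Iic_union_Ioc_eq_Iic (by linarith)).symm
  have h2 : (gaussianReal 0 1).real (Set.Ioc t (t + r)) ≤ r := by
    rw [measureReal_def]
    refine ENNReal.toReal_le_of_le_ofReal hr ?_
    rw [gaussianReal_apply _ one_ne_zero]
    calc ∫⁻ x in Set.Ioc t (t + r), gaussianPDF 0 1 x ≤ ∫⁻ _ in Set.Ioc t (t + r), 1 := by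
          refine lintegral_mono fun x => ?_
          rw [gaussianPDF, ← ENNReal.ofReal_one]
          exact ENNReal.ofReal_le_ofReal (gaussianPDFReal_zero_one_le_one x)
      _ = ENNReal.ofReal r := by simp
  rw [h1]
  exact (measureReal_union_le _ _).trans (by gcongr)

/-- Weak convergence is convergence in the Lévy-Prokhorov metric. Applied to half-lines, that metric
compares distribution functions up to a shift and an error of `ε / 2` each, simultaneously for all
`t`; the Lipschitz bound on `Φ` absorbs the shift. -/
theorem eventually_forall_abs_cdf_sub_le_of_tendsto {μ : ℕ → ProbabilityMeasure ℝ}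
    (h : Tendsto μ atTop (𝓝 ⟨gaussianReal 0 1, inferInstance⟩)) {ε : ℝ} (hε : 0 < ε) :
    ∀ᶠ n in atTop, ∀ t,
      |(μ n : Measure ℝ).real (Set.Iic t) - cdf (gaussianReal 0 1) t| ≤ ε := by
  have h1 := (LevyProkhorov.probabilityMeasureHomeomorph (Ω := ℝ)).continuous.continuousAt.tendsto.comp h
  have hε2 : 0 < ε / 2 := by linarith
  have h2 := (EMetric.tendsto_nhds.1 h1) (ENNReal.ofReal (ε / 2)) (by simpa using hε2)
  filter_upwards [h2] with n hn t
  have hn' : levyProkhorovEDist (μ n : Measure ℝ) (gaussianReal 0 1) < ENNReal.ofReal (ε / 2) := hn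
  have hr : (ENNReal.ofReal (ε / 2)).toReal = ε / 2 := ENNReal.toReal_ofReal hε2.le
  have hthick : ∀ s : ℝ, Metric.thickening (ε / 2) (Set.Iic s) ⊆ Set.Iic (s + ε / 2) := by
    intro s x hx
    obtain ⟨y, hy, hxy⟩ := Metric.mem_thickening_iff.1 hx
    rw [Real.dist_eq] at hxy
    have := (abs_lt.1 hxy).2
    simp only [Set.mem_Iic] at hy ⊢
    linarith
  have hgen : ∀ (α β : Measure ℝ) [IsProbabilityMeasure α] [IsProbabilityMeasure β] (s : ℝ),
      α (Set.Iic s) ≤ β (Metric.thickening (ε / 2) (Set.Iic s)) + ENNReal.ofReal (ε / 2) →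
      α.real (Set.Iic s) ≤ β.real (Set.Iic (s + ε / 2)) + ε / 2 := by
    intro α β _ _ s h
    have h3 : α (Set.Iic s) ≤ β (Set.Iic (s + ε / 2)) + ENNReal.ofReal (ε / 2) :=
      h.trans (by gcongr; exact hthick s)
    have h4 := ENNReal.toReal_mono (by finiteness) h3
    rwa [ENNReal.toReal_add (by finiteness) (by finiteness), hr] at h4
  have hl := left_measure_le_of_levyProkhorovEDist_lt hn' (measurableSet_Iic (a := t))
  have hu := right_measure_le_of_levyProkhorovEDist_lt hn' (measurableSet_Iic (a := t - ε / 2))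
  rw [hr] at hl hu
  have hl' := hgen _ _ _ hl
  have hu' := hgen _ _ _ hu
  rw [← cdf_eq_real (gaussianReal 0 1)] at hl' hu'
  rw [sub_add_cancel] at hu'
  have h5 := cdf_gaussianReal_add_le t hε2.le
  have h6 := cdf_gaussianReal_add_le (t - ε / 2) hε2.le
  rw [sub_add_cancel] at h6
  rw [abs_le]
  constructor <;> linarith

/-- A central limit theorem for weighted sums of independent errors, uniform in the laws of the
errors, in the number of summands and in the weights. -/
theorem exists_forall_abs_measureReal_weighted_sum_le_sub_cdf_le {δ c C ε : ℝ} (hδ : 0 < δ)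
    (hδ1 : δ ≤ 1) (hc : 0 < c) (hC : 0 ≤ C) (hε : 0 < ε) :
    ∃ m : ℝ, 0 < m ∧ ∀ (n : ℕ) (ν : Fin n → Measure ℝ), (∀ i, IsProbabilityMeasure (ν i)) →
      (∀ i, IsErrorLaw (ν i) δ c C) → ∀ w : Fin n → ℝ, (∀ i, |w i| ≤ m) →
      ∑ i, w i ^ 2 * ∫ x, x ^ 2 ∂ν i = 1 → ∀ t : ℝ,
      |(Measure.pi ν).real {x | ∑ i, w i * x i ≤ t} - cdf (gaussianReal 0 1) t| ≤ ε := by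
  -- A failure for every threshold `1 / (k + 1)` yields a sequence of weighted sums whose weights
  -- shrink to `0`. Its characteristic functions converge, contradicting the failure. The number of
  -- summands needs no separate control.
  by_contra! hcon
  choose n ν hprob hν w hw hvar t ht using
    fun k : ℕ => hcon (1 / ((k : ℝ) + 1)) Nat.one_div_pos_of_nat
  have hmeas : ∀ k, Measurable fun x : Fin (n k) → ℝ => ∑ i, w k i * x i := fun k => by fun_prop
  let μ : ℕ → ProbabilityMeasure ℝ := fun k =>
    ⟨(Measure.pi (ν k)).map fun x => ∑ i, w k i * x i,
      Measure.isProbabilityMeasure_map (hmeas k).aemeasurable⟩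
  have hlim : Tendsto μ atTop (𝓝 ⟨gaussianReal 0 1, inferInstance⟩) := by
    refine ProbabilityMeasure.tendsto_of_tendsto_charFun fun s => ?_
    rw [tendsto_iff_norm_sub_tendsto_zero]
    have hm : Tendsto (fun k : ℕ => 1 / ((k : ℝ) + 1)) atTop (𝓝 0) :=
      tendsto_one_div_add_atTop_nhds_zero_nat
    have hb : Tendsto (fun k : ℕ => 4 * |s| ^ (2 + δ) * C * ((1 / ((k : ℝ) + 1)) ^ δ * c⁻¹) +
        s ^ 4 / 4 * ((1 / ((k : ℝ) + 1)) ^ 2 * (1 + C))) atTop (𝓝 0) := by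
      have h1 := (((hm.rpow_const (p := δ) (Or.inr hδ.le)).mul_const c⁻¹).const_mul
        (4 * |s| ^ (2 + δ) * C)).add (((hm.pow 2).mul_const (1 + C)).const_mul (s ^ 4 / 4))
      rw [Real.zero_rpow hδ.ne'] at h1
      simpa using h1
    refine squeeze_zero (fun _ => norm_nonneg _) (fun k => ?_) hb
    have := norm_charFun_weighted_sum_sub_le hδ.le hδ1 hc hC (ν k) (hν k)
      (Nat.one_div_pos_of_nat.le) (hw k) (hvar k) s
    refine (le_of_eq ?_).trans this
    congr 2
    rw [ProbabilityMeasure.coe_mk, charFun_gaussianReal]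
    congr 1
    push_cast
    ring
  obtain ⟨k, hk⟩ := (eventually_forall_abs_cdf_sub_le_of_tendsto hlim hε).exists
  have h1 := hk (t k)
  refine absurd h1 (not_le.2 ?_)
  rw [ProbabilityMeasure.coe_mk, map_measureReal_apply (hmeas k) measurableSet_Iic]
  exact ht k

/-! ### The weak law for weighted squared errors -/

theorem IsErrorLaw.abs_sq_sub_variance_rpow_le {ν : Measure ℝ} [IsProbabilityMeasure ν]
    {δ c C : ℝ} (h : IsErrorLaw ν δ c C) (hδ : 0 ≤ δ) (hδ1 : δ ≤ 2) (hc : 0 ≤ c) (hC : 0 ≤ C)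
    (x : ℝ) :
    |x ^ 2 - ∫ y, y ^ 2 ∂ν| ^ (1 + δ / 2) ≤ |x| ^ (2 + δ) + (1 + C) ^ 2 := by
  have hs := h.variance_le hδ
  have hs0 : 0 ≤ ∫ y, y ^ 2 ∂ν := hc.trans h.le_variance
  have hx : (x ^ 2) ^ (1 + δ / 2) = |x| ^ (2 + δ) := by
    rw [← sq_abs, ← Real.rpow_natCast, ← Real.rpow_mul (abs_nonneg _)]
    congr 1; push_cast; ring
  have hC2 : (1 + C) ^ (1 + δ / 2) ≤ (1 + C) ^ 2 := by
    rw [← Real.rpow_natCast]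
    exact Real.rpow_le_rpow_of_exponent_le (by linarith) (by push_cast; linarith)
  have hp : 0 ≤ 1 + δ / 2 := by linarith
  have h0 : 0 ≤ |x| ^ (2 + δ) := by positivity
  have h1 : |x ^ 2 - ∫ y, y ^ 2 ∂ν| ≤ max (x ^ 2) (1 + C) := by
    rw [abs_le]
    constructor
    · linarith [le_max_right (x ^ 2) (1 + C), sq_nonneg x]
    · linarith [le_max_left (x ^ 2) (1 + C)]
  refine (Real.rpow_le_rpow (abs_nonneg _) h1 hp).trans ?_
  rcases max_choice (x ^ 2) (1 + C) with h2 | h2 <;> rw [h2]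
  · rw [hx]; linarith [sq_nonneg (1 + C)]
  · linarith

/-- Squared errors may lack a second moment, so Chebyshev's inequality is unavailable. Instead each
factor is within a `(1 + δ/2)`-th moment of `1`, and `|v_i²|^(1 + δ/2) = |v_i|^(2 + δ)` reduces to
the Lyapunov sum. -/
theorem norm_charFun_weighted_sum_sq_sub_one_le {ι : Type*} [Fintype ι] {δ c C : ℝ} (hδ : 0 ≤ δ)
    (hδ1 : δ ≤ 2) (hc : 0 ≤ c) (hC : 0 ≤ C) (ν : ι → Measure ℝ) [∀ i, IsProbabilityMeasure (ν i)]
    (hν : ∀ i, IsErrorLaw (ν i) δ c C) {v : ι → ℝ} {m : ℝ} (hv : ∀ i, |v i| ≤ m)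
    (hsum : ∑ i, v i ^ 2 = 1) (t : ℝ) :
    ‖1 - charFun ((Measure.pi ν).map fun x => ∑ i, v i ^ 2 * (x i ^ 2 - ∫ y, y ^ 2 ∂ν i)) t‖ ≤
      3 * |t| ^ (1 + δ / 2) * (C + (1 + C) ^ 2) * m ^ δ := by
  rw [norm_sub_rev, charFun_map_sum_pi ν (fun i x => v i ^ 2 * (x ^ 2 - ∫ y, y ^ 2 ∂ν i))
    (fun i => by fun_prop)]
  have h1 := norm_prod_sub_prod_le Finset.univ
    (fun i => ∫ x, Complex.exp ((t * (v i ^ 2 * (x ^ 2 - ∫ y, y ^ 2 ∂ν i)) : ℝ) * Complex.I) ∂ν i)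
    (fun _ => 1) (fun i => norm_integral_cexp_mul_I_le_one _) (fun i => by simp)
  rw [Finset.prod_const_one] at h1
  refine h1.trans ?_
  have hterm : ∀ i, ‖∫ x, Complex.exp ((t * (v i ^ 2 * (x ^ 2 - ∫ y, y ^ 2 ∂ν i)) : ℝ) *
      Complex.I) ∂ν i - 1‖ ≤
      3 * |t| ^ (1 + δ / 2) * (C + (1 + C) ^ 2) * |v i| ^ (2 + δ) := by
    intro i
    have hi2 := (hν i).integrable_sq hδ
    have hi : Integrable (fun x : ℝ => x ^ 2 - ∫ y, y ^ 2 ∂ν i) (ν i) :=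
      hi2.sub (integrable_const _)
    have h0 : ∫ x, (x ^ 2 - ∫ y, y ^ 2 ∂ν i) ∂ν i = 0 := by
      rw [integral_sub hi2 (integrable_const _)]; simp
    have hb := (hν i).abs_sq_sub_variance_rpow_le hδ hδ1 hc hC
    have hbi : Integrable (fun x : ℝ => |x| ^ (2 + δ) + (1 + C) ^ 2) (ν i) :=
      (hν i).integrable_rpow.add (integrable_const _)
    have hip : Integrable (fun x : ℝ => |x ^ 2 - ∫ y, y ^ 2 ∂ν i| ^ (1 + δ / 2)) (ν i) := by
      refine hbi.mono' (Measurable.aestronglyMeasurable (by fun_prop)) (ae_of_all _ fun x => ?_)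
      rw [Real.norm_of_nonneg (by positivity)]
      exact hb x
    have hm : ∫ x, |x ^ 2 - ∫ y, y ^ 2 ∂ν i| ^ (1 + δ / 2) ∂ν i ≤ C + (1 + C) ^ 2 := by
      refine (integral_mono hip hbi hb).trans ?_
      rw [integral_add (hν i).integrable_rpow (integrable_const _)]
      simpa using (hν i).moment_le
    have h2 := norm_integral_cexp_sub_one_le (ν := ν i) (p := 1 + δ / 2) (by fun_prop)
      (by linarith) (by linarith) hi h0 hip (t * v i ^ 2)
    have h3 : |v i ^ 2| ^ (1 + δ / 2) = |v i| ^ (2 + δ) := by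
      rw [abs_pow, ← Real.rpow_natCast, ← Real.rpow_mul (abs_nonneg _)]
      congr 1; push_cast; ring
    rw [abs_mul, Real.mul_rpow (abs_nonneg _) (abs_nonneg _), h3] at h2
    simp only [← mul_assoc]
    refine h2.trans ?_
    calc _ ≤ 3 * (|t| ^ (1 + δ / 2) * |v i| ^ (2 + δ)) * (C + (1 + C) ^ 2) := by gcongr
      _ = _ := by ring
  refine (Finset.sum_le_sum fun i _ => hterm i).trans ?_
  rw [← Finset.mul_sum]
  have h7 : ∑ i, |v i| ^ (2 + δ) ≤ m ^ δ := by
    simpa [hsum] using sum_abs_rpow_le hδ hv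
  gcongr

/-- A weak law of large numbers for weighted sums of squared errors, uniform in the laws of the
errors, in the number of summands and in the weights. -/
theorem exists_forall_measureReal_weighted_sum_sq_le {δ c C η ε : ℝ} (hδ : 0 < δ)
    (hδ1 : δ ≤ 2) (hc : 0 ≤ c) (hC : 0 ≤ C) (hη : 0 < η) (hε : 0 < ε) :
    ∃ m : ℝ, 0 < m ∧ ∀ (n : ℕ) (ν : Fin n → Measure ℝ), (∀ i, IsProbabilityMeasure (ν i)) →
      (∀ i, IsErrorLaw (ν i) δ c C) → ∀ v : Fin n → ℝ, (∀ i, |v i| ≤ m) →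
      ∑ i, v i ^ 2 = 1 →
      (Measure.pi ν).real {x | η < |∑ i, v i ^ 2 * (x i ^ 2 - ∫ y, y ^ 2 ∂ν i)|} ≤ ε := by
  -- The tail bound integrates `1 - charFun` over `[-2/η, 2/η]`. Here `B` collects its prefactor `η
  -- / 2`, the largest value of the pointwise bound without `m ^ δ`, and the length of the interval.
  set B : ℝ := 2⁻¹ * η * ((3 * (2 * η⁻¹) ^ (1 + δ / 2) * (C + (1 + C) ^ 2)) * |2 * η⁻¹ - -2 * η⁻¹|)
    with hB
  have hlim : Tendsto (fun m : ℝ => B * m ^ δ) (𝓝[>] 0) (𝓝 0) := by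
    have h1 : Tendsto (fun m : ℝ => B * m ^ δ) (𝓝 0) (𝓝 (B * 0 ^ δ)) :=
      (tendsto_id.rpow_const (Or.inr hδ.le)).const_mul B
    rw [Real.zero_rpow hδ.ne', mul_zero] at h1
    exact h1.mono_left nhdsWithin_le_nhds
  obtain ⟨m, hm, hm0⟩ := ((hlim.eventually (ge_mem_nhds hε)).and self_mem_nhdsWithin).exists
  refine ⟨m, hm0, fun n ν hprob hν v hv hsum => ?_⟩
  have hmeas : Measurable fun x : Fin n → ℝ => ∑ i, v i ^ 2 * (x i ^ 2 - ∫ y, y ^ 2 ∂ν i) := by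
    fun_prop
  have : IsProbabilityMeasure
      ((Measure.pi ν).map fun x => ∑ i, v i ^ 2 * (x i ^ 2 - ∫ y, y ^ 2 ∂ν i)) :=
    Measure.isProbabilityMeasure_map hmeas.aemeasurable
  have h1 := measureReal_abs_gt_le_integral_charFun
    (μ := (Measure.pi ν).map fun x => ∑ i, v i ^ 2 * (x i ^ 2 - ∫ y, y ^ 2 ∂ν i)) hη
  rw [map_measureReal_apply hmeas (measurableSet_lt measurable_const (by fun_prop))] at h1
  refine h1.trans (le_trans ?_ hm)
  have h2 := intervalIntegral.norm_integral_le_of_norm_le_const (a := -2 * η⁻¹) (b := 2 * η⁻¹)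
    (f := fun t => 1 - charFun
      ((Measure.pi ν).map fun x => ∑ i, v i ^ 2 * (x i ^ 2 - ∫ y, y ^ 2 ∂ν i)) t)
    (C := 3 * (2 * η⁻¹) ^ (1 + δ / 2) * (C + (1 + C) ^ 2) * m ^ δ) (fun t ht => by
      refine (norm_charFun_weighted_sum_sq_sub_one_le hδ.le hδ1 hc hC ν hν hv hsum t).trans ?_
      have hη' : 0 < η⁻¹ := inv_pos.2 hη
      rw [Set.uIoc_of_le (by linarith), Set.mem_Ioc] at ht
      have : |t| ≤ 2 * η⁻¹ := abs_le.2 ⟨by linarith, ht.2⟩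
      have hm0' : 0 ≤ m ^ δ := Real.rpow_nonneg (le_of_lt hm0) _
      gcongr)
  calc _ ≤ 2⁻¹ * η * _ := mul_le_mul_of_nonneg_left h2 (by positivity)
    _ = B * m ^ δ := by rw [hB]; ring

/-! ### Product kernels and integration of conditional bounds -/

/-- The kernel mapping a vector `(a_i)` to the product of the laws `κ (a_i)`. -/
def piKernel (ι : Type*) [Fintype ι] {A B : Type*} [MeasurableSpace A] [MeasurableSpace B]
    (κ : Kernel A B) [IsMarkovKernel κ] : Kernel (ι → A) (ι → B) where
  toFun a := Measure.pi fun i => κ (a i)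
  measurable' := by
    refine Measurable.measure_of_isPiSystem_of_isProbabilityMeasure generateFrom_pi.symm
      isPiSystem_pi ?_
    rintro _ ⟨s, hs, rfl⟩
    simp only [Measure.pi_pi]
    exact Finset.measurable_fun_prod _ fun i _ =>
      (κ.measurable_coe (hs i (Set.mem_univ i))).comp (measurable_pi_apply i)

section PiKernel

variable {ι : Type*} [Fintype ι] {A B : Type*} [MeasurableSpace A] [MeasurableSpace B]
  (κ : Kernel A B) [IsMarkovKernel κ]

theorem piKernel_apply (a : ι → A) : piKernel ι κ a = Measure.pi fun i => κ (a i) := rfl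

instance : IsMarkovKernel (piKernel ι κ) :=
  ⟨fun a => by rw [piKernel_apply]; infer_instance⟩

/-- Drawing independent pairs amounts to drawing all first coordinates and then, given these,
independent second coordinates. On boxes both sides are products of integrals over the single
coordinates. -/
theorem pi_compProd_eq_map (α : Measure A) [IsProbabilityMeasure α] :
    (Measure.pi fun _ : ι => α ⊗ₘ κ) =
      ((Measure.pi fun _ : ι => α) ⊗ₘ piKernel ι κ).map fun q i => (q.1 i, q.2 i) := by
  have hmeas : Measurable fun (q : (ι → A) × (ι → B)) i => (q.1 i, q.2 i) := by fun_prop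
  refine Measure.pi_eq fun s hs => ?_
  rw [Measure.map_apply hmeas (MeasurableSet.univ_pi hs),
    Measure.compProd_apply (hmeas (MeasurableSet.univ_pi hs))]
  have h1 : ∀ a : ι → A, piKernel ι κ a (Prod.mk a ⁻¹'
      ((fun (q : (ι → A) × (ι → B)) i => (q.1 i, q.2 i)) ⁻¹' Set.univ.pi s)) =
      ∏ i, κ (a i) (Prod.mk (a i) ⁻¹' s i) := by
    intro a
    rw [piKernel_apply, ← Measure.pi_pi]
    congr 1
  have hk : ∀ i, Measurable fun b => κ b (Prod.mk b ⁻¹' s i) := fun i =>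
    Kernel.measurable_kernel_prodMk_left (hs i)
  simp only [h1]
  rw [lintegral_prod_eq_prod_lintegral_of_indepFun Finset.univ
    (fun i (a : ι → A) => κ (a i) (Prod.mk (a i) ⁻¹' s i))
    (iIndepFun_pi (μ := fun _ : ι => α) (X := fun i b => κ b (Prod.mk b ⁻¹' s i))
      fun i => (hk i).aemeasurable) fun i => (hk i).comp (measurable_pi_apply i)]
  refine Finset.prod_congr rfl fun i _ => ?_
  rw [Measure.compProd_apply (hs i)]
  exact (measurePreserving_eval (fun _ : ι => α) i).lintegral_comp (hk i)

end PiKernel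

/-- By Fubini the probability is the mean of conditional probabilities. On `G` these are within `ε`
of `q`; off `G` the gap is at most `1`, both numbers lying in `[0, 1]`. -/
theorem abs_measureReal_compProd_prod_sub_le {A B Θ : Type*} [MeasurableSpace A]
    [MeasurableSpace B] [MeasurableSpace Θ] (α : Measure A) [IsProbabilityMeasure α]
    (K : Kernel A B) [IsMarkovKernel K] (Λ : Measure Θ) [IsProbabilityMeasure Λ]
    {G : Set (A × Θ)} (hG : MeasurableSet G) {E : Set ((A × B) × Θ)} (hE : MeasurableSet E)
    {q ε : ℝ} (hq0 : 0 ≤ q) (hq1 : q ≤ 1) (hε : 0 ≤ ε)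
    (h : ∀ᵐ a ∂α, ∀ θ, (a, θ) ∈ G → |(K a).real {b | ((a, b), θ) ∈ E} - q| ≤ ε) :
    |((α ⊗ₘ K).prod Λ).real E - q| ≤ ε + (α.prod Λ).real Gᶜ := by
  set f : A × Θ → ℝ≥0∞ := fun p => K p.1 {b | ((p.1, b), p.2) ∈ E} with hf
  have hE' : MeasurableSet {r : (A × Θ) × B | ((r.1.1, r.2), r.1.2) ∈ E} :=
    hE.preimage (by fun_prop)
  have hfm : Measurable f := by
    have := Kernel.measurable_kernel_prodMk_left (κ := Kernel.prodMkRight Θ K) hE'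
    exact this
  have h1 : ((α ⊗ₘ K).prod Λ) E = ∫⁻ p, f p ∂(α.prod Λ) := by
    rw [Measure.prod_apply_symm hE, lintegral_prod_symm _ hfm.aemeasurable]
    refine lintegral_congr fun θ => ?_
    rw [Measure.compProd_apply (hE.preimage (by fun_prop))]
    rfl
  have hf1 : ∀ p, f p ≤ 1 := fun p => prob_le_one
  have h2 : ((α ⊗ₘ K).prod Λ).real E = ∫ p, (f p).toReal ∂(α.prod Λ) := by
    rw [measureReal_def, h1, integral_toReal hfm.aemeasurable
      (ae_of_all _ fun p => (hf1 p).trans_lt ENNReal.one_lt_top)]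
  have hfi : Integrable (fun p => (f p).toReal) (α.prod Λ) := by
    refine Integrable.of_bound (C := 1) hfm.ennreal_toReal.aestronglyMeasurable
      (ae_of_all _ fun p => ?_)
    rw [Real.norm_of_nonneg ENNReal.toReal_nonneg]
    exact ENNReal.toReal_le_of_le_ofReal zero_le_one (by simpa using hf1 p)
  have h3 : ((α ⊗ₘ K).prod Λ).real E - q = ∫ p, ((f p).toReal - q) ∂(α.prod Λ) := by
    rw [integral_sub hfi (integrable_const _), h2]; simp
  have hae : ∀ᵐ p ∂(α.prod Λ), p ∈ G → |(f p).toReal - q| ≤ ε := by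
    have := (Measure.quasiMeasurePreserving_fst (μ := α) (ν := Λ)).ae h
    filter_upwards [this] with p hp hpG
    exact hp p.2 hpG
  rw [h3, ← Real.norm_eq_abs]
  have hbi : Integrable (fun p => ε + Gᶜ.indicator (fun _ => (1 : ℝ)) p) (α.prod Λ) :=
    (integrable_const _).add ((integrable_const _).indicator hG.compl)
  refine (norm_integral_le_of_norm_le hbi ?_).trans_eq ?_
  · filter_upwards [hae] with p hp
    rw [Real.norm_eq_abs]
    by_cases hpG : p ∈ G
    · simpa [hpG] using hp hpG
    · have h4 : (f p).toReal ≤ 1 :=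
        ENNReal.toReal_le_of_le_ofReal zero_le_one (by simpa using hf1 p)
      have h5 : 0 ≤ (f p).toReal := ENNReal.toReal_nonneg
      rw [Set.indicator_of_mem (by simpa using hpG), abs_le]
      constructor <;> linarith
  · rw [integral_add (integrable_const _) ((integrable_const _).indicator hG.compl),
      integral_indicator_const _ hG.compl]
    simp

/-! ### Conditional law of the noise given the covariates -/

section Conditioning

variable {𝒳 : Type*} [MeasurableSpace 𝒳] {d : ℕ}

/-- The pair `(X, Z)` of an observation. -/
def covariates (w : Obs 𝒳 d) : 𝒳 × (Fin d → ℝ) := (w.1, w.2.2)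

@[fun_prop]
theorem measurable_covariates : Measurable (covariates : Obs 𝒳 d → _) := by
  unfold covariates; fun_prop

@[fun_prop]
theorem measurable_noise (γ : Fin d → ℝ) : Measurable (noise γ : Obs 𝒳 d → ℝ) := by
  unfold noise dotProduct; fun_prop

/-- The conditional law of the noise given `(X, Z)`. -/
def noiseKernel (P : Measure (Obs 𝒳 d)) [IsFiniteMeasure P] (γ : Fin d → ℝ) :
    Kernel (𝒳 × (Fin d → ℝ)) ℝ := condDistrib (noise γ) covariates P

instance (P : Measure (Obs 𝒳 d)) [IsFiniteMeasure P] (γ : Fin d → ℝ) :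
    IsMarkovKernel (noiseKernel P γ) := by unfold noiseKernel; infer_instance

/-- Conditional expectations of functions of the noise are integrals against its regular conditional
law, so the moment assumptions become statements about almost every fibre. -/
theorem ae_isErrorLaw_noiseKernel (P : Measure (Obs 𝒳 d)) [IsProbabilityMeasure P]
    {γ : Fin d → ℝ} {δ c C : ℝ} (hδ : 0 ≤ δ) (hnull : NullLinearModel P γ)
    (hmom : NoiseMoments P γ δ c C) :
    ∀ᵐ a ∂P.map covariates, IsErrorLaw (noiseKernel P γ a) δ c C := by
  have hX : Measurable (covariates : Obs 𝒳 d → _) := measurable_covariates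
  have hY : Measurable (noise γ : Obs 𝒳 d → ℝ) := measurable_noise γ
  obtain ⟨hi, h0⟩ := hnull
  obtain ⟨hiq, hc, hC⟩ := hmom
  have hi2 : Integrable (fun w => noise γ w ^ 2) P := by
    refine ((integrable_const 1).add hiq).mono' (by fun_prop) (ae_of_all _ fun x => ?_)
    rw [Real.norm_of_nonneg (sq_nonneg _)]
    exact IsErrorLaw.sq_le hδ _
  have hqm : Measurable fun x : ℝ => |x| ^ (2 + δ) := by fun_prop
  have e1 := condExp_ae_eq_integral_condDistrib (μ := P) hX hY.aemeasurable
    (f := fun x : ℝ => x) stronglyMeasurable_id hi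
  have e2 := condExp_ae_eq_integral_condDistrib (μ := P) hX hY.aemeasurable
    (f := fun x : ℝ => x ^ 2) (by fun_prop) hi2
  have e3 := condExp_ae_eq_integral_condDistrib (μ := P) hX hY.aemeasurable
    (f := fun x : ℝ => |x| ^ (2 + δ)) hqm.stronglyMeasurable hiq
  have hint : ∀ f : ℝ → ℝ, Measurable f → Integrable (fun w => f (noise γ w)) P →
      ∀ᵐ a ∂P.map covariates, Integrable f (noiseKernel P γ a) := fun f hf hfi =>
    Integrable.condDistrib_ae_map (f := fun p : (𝒳 × (Fin d → ℝ)) × ℝ => f p.2) hY.aemeasurable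
      ((integrable_map_measure (hf.comp measurable_snd).aestronglyMeasurable (by fun_prop)).2 hfi)
  have hsm : ∀ f : ℝ → ℝ, Measurable f →
      Measurable fun a => ∫ y, f y ∂noiseKernel P γ a := fun f hf =>
    (StronglyMeasurable.integral_kernel (κ := noiseKernel P γ) hf.stronglyMeasurable).measurable
  have m1 : ∀ᵐ a ∂P.map covariates, ∫ y, y ∂noiseKernel P γ a = 0 := by
    rw [ae_map_iff hX.aemeasurable (measurableSet_eq_fun (hsm (fun y => y) measurable_id) measurable_const)]
    filter_upwards [e1, h0] with w hw hw0
    exact hw.symm.trans hw0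
  have m2 : ∀ᵐ a ∂P.map covariates, c ≤ ∫ y, y ^ 2 ∂noiseKernel P γ a := by
    rw [ae_map_iff hX.aemeasurable (measurableSet_le measurable_const (hsm _ (by fun_prop)))]
    filter_upwards [e2, hc] with w hw hw0
    exact hw0.trans_eq hw
  have m3 : ∀ᵐ a ∂P.map covariates, ∫ y, |y| ^ (2 + δ) ∂noiseKernel P γ a ≤ C := by
    rw [ae_map_iff hX.aemeasurable (measurableSet_le (hsm _ hqm) measurable_const)]
    filter_upwards [e3, hC] with w hw hw0
    exact hw.symm.trans_le hw0
  filter_upwards [hint _ measurable_id hi, hint _ hqm hiq, m1, m2, m3] with a a1 a2 a3 a4 a5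
  exact ⟨a1, a3, a2, a4, a5⟩

theorem map_pi_covariates_noise (n : ℕ) (P : Measure (Obs 𝒳 d)) [IsProbabilityMeasure P]
    (γ : Fin d → ℝ) :
    (Measure.pi fun _ : Fin n => P).map
        (fun w => ((fun i => covariates (w i)), fun i => noise γ (w i))) =
      (Measure.pi fun _ : Fin n => P.map covariates) ⊗ₘ piKernel (Fin n) (noiseKernel P γ) := by
  have hX : Measurable (covariates : Obs 𝒳 d → _) := measurable_covariates
  have hY : Measurable (noise γ : Obs 𝒳 d → ℝ) := measurable_noise γ
  have : IsProbabilityMeasure (P.map covariates) :=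
    Measure.isProbabilityMeasure_map hX.aemeasurable
  have h1 : P.map (fun w => (covariates w, noise γ w)) = P.map covariates ⊗ₘ noiseKernel P γ :=
    (compProd_map_condDistrib hY.aemeasurable).symm
  have h2 := Measure.pi_map_pi (μ := fun _ : Fin n => P)
    (f := fun _ w => (covariates w, noise γ w)) (hμ := fun _ => by rw [h1]; infer_instance)
    (fun _ => by fun_prop)
  simp only [h1] at h2
  rw [pi_compProd_eq_map] at h2
  have hunzip : Measurable fun v : Fin n → (𝒳 × (Fin d → ℝ)) × ℝ =>
    ((fun i => (v i).1), fun i => (v i).2) := by fun_prop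
  have h3 := congrArg (Measure.map fun v : Fin n → (𝒳 × (Fin d → ℝ)) × ℝ =>
    ((fun i => (v i).1), fun i => (v i).2)) h2
  rw [Measure.map_map hunzip (by fun_prop), Measure.map_map hunzip (by fun_prop)] at h3
  refine h3.trans ?_
  -- Unzipping after zipping is the identity by definitional unfolding.
  exact Measure.map_id

end Conditioning

section SampleLaw

variable {n d : ℕ} {𝒳 𝒮 : Type*} [MeasurableSpace 𝒳] [MeasurableSpace 𝒮]

instance (P : ProbabilityMeasure (Obs 𝒳 d)) (ρ : Measure 𝒮) [IsProbabilityMeasure ρ] :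
    IsProbabilityMeasure (sampleLaw n P ρ) := by unfold sampleLaw; infer_instance

/-- The covariates of `D₁`, the sample `D₂` and the seed. -/
def design (ω : Sample n 𝒳 d 𝒮) : (Fin n → 𝒳 × (Fin d → ℝ)) × ((Fin n → Obs 𝒳 d) × 𝒮) :=
  (fun i => covariates (ω.1 i), ω.2)

/-- Approximating the probability of an event by a constant via its conditional probability given
the design. -/
theorem abs_sampleLaw_real_sub_le (P : ProbabilityMeasure (Obs 𝒳 d)) (ρ : Measure 𝒮)
    [IsProbabilityMeasure ρ] {γ : Fin d → ℝ} {δ c C : ℝ} (hδ : 0 ≤ δ)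
    (hnull : NullLinearModel (P : Measure (Obs 𝒳 d)) γ)
    (hmom : NoiseMoments (P : Measure (Obs 𝒳 d)) γ δ c C)
    {G : Set ((Fin n → 𝒳 × (Fin d → ℝ)) × ((Fin n → Obs 𝒳 d) × 𝒮))} (hG : MeasurableSet G)
    {E : Set (((Fin n → 𝒳 × (Fin d → ℝ)) × (Fin n → ℝ)) × ((Fin n → Obs 𝒳 d) × 𝒮))}
    (hE : MeasurableSet E) {q ε : ℝ} (hq0 : 0 ≤ q) (hq1 : q ≤ 1) (hε : 0 ≤ ε)
    (h : ∀ a θ, (∀ i, IsErrorLaw (noiseKernel (P : Measure (Obs 𝒳 d)) γ (a i)) δ c C) →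
      (a, θ) ∈ G →
      |(Measure.pi fun i => noiseKernel (P : Measure (Obs 𝒳 d)) γ (a i)).real
        {b | ((a, b), θ) ∈ E} - q| ≤ ε) :
    |(sampleLaw n P ρ).real {ω | (((design ω).1, fun i => noise γ (ω.1 i)), ω.2) ∈ E} - q| ≤
      ε + (sampleLaw n P ρ).real {ω | design ω ∉ G} := by
  have hX : Measurable (covariates : Obs 𝒳 d → _) := measurable_covariates
  have : IsProbabilityMeasure ((P : Measure (Obs 𝒳 d)).map covariates) :=
    Measure.isProbabilityMeasure_map hX.aemeasurable
  set A : Measure (Fin n → Obs 𝒳 d) := Measure.pi fun _ : Fin n => (P : Measure (Obs 𝒳 d))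
  set Λ : Measure ((Fin n → Obs 𝒳 d) × 𝒮) := A.prod ρ with hΛ
  set α : Measure (Fin n → 𝒳 × (Fin d → ℝ)) :=
    Measure.pi fun _ : Fin n => (P : Measure (Obs 𝒳 d)).map covariates with hα
  have hmapA : A.map (fun w i => covariates (w i)) = α :=
    Measure.pi_map_pi (fun _ => hX.aemeasurable)
  have hm1 : Measurable fun w : Fin n → Obs 𝒳 d =>
    ((fun i => covariates (w i)), fun i => noise γ (w i)) := by fun_prop
  have hm2 : Measurable fun (w : Fin n → Obs 𝒳 d) i => covariates (w i) := by fun_prop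
  have h1 : (sampleLaw n P ρ).map
      (Prod.map (fun w : Fin n → Obs 𝒳 d =>
        ((fun i => covariates (w i)), fun i => noise γ (w i))) id) =
      (α ⊗ₘ piKernel (Fin n) (noiseKernel (P : Measure (Obs 𝒳 d)) γ)).prod Λ := by
    rw [← map_pi_covariates_noise, sampleLaw, ← Measure.map_prod_map _ _ hm1 measurable_id,
      Measure.map_id]
  have h2 : (sampleLaw n P ρ).map (Prod.map (fun (w : Fin n → Obs 𝒳 d) i => covariates (w i)) id) =
      α.prod Λ := by
    rw [← hmapA, sampleLaw, ← Measure.map_prod_map _ _ hm2 measurable_id, Measure.map_id]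
  have hae : ∀ᵐ a ∂α, ∀ i, IsErrorLaw (noiseKernel (P : Measure (Obs 𝒳 d)) γ (a i)) δ c C := by
    rw [ae_all_iff]
    intro i
    exact (Measure.quasiMeasurePreserving_eval
      (fun _ : Fin n => (P : Measure (Obs 𝒳 d)).map covariates) i).ae
      (ae_isErrorLaw_noiseKernel _ hδ hnull hmom)
  have h3 := abs_measureReal_compProd_prod_sub_le α
    (piKernel (Fin n) (noiseKernel (P : Measure (Obs 𝒳 d)) γ)) Λ hG hE hq0 hq1 hε
    (by filter_upwards [hae] with a ha θ hθ using h a θ ha hθ)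
  rw [← h1, ← h2, map_measureReal_apply (by fun_prop) hE,
    map_measureReal_apply (by fun_prop) hG.compl] at h3
  exact h3

end SampleLaw

/-! ### Deterministic comparison with the oracle statistic -/

theorem half_le_sqrt_one_add {r : ℝ} (hr : |r| ≤ 1 / 2) :
    1 / 2 ≤ √(1 + r) ∧ |1 / √(1 + r) - 1| ≤ |r| := by
  have h1 := (abs_le.1 hr).1
  set y := √(1 + r) with hy
  have hy2 : y ^ 2 = 1 + r := Real.sq_sqrt (by linarith)
  have hy1 : 1 / 2 ≤ y := by rw [hy]; exact Real.le_sqrt_of_sq_le (by linarith)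
  refine ⟨hy1, ?_⟩
  have hy0 : 0 < y := by linarith
  have h2 : 1 / y - 1 = (1 - y) / y := by field_simp
  -- With `r = (y - 1)(1 + y)` the claim reduces to `1 ≤ y + y²`, which holds because `y` and `y² =
  -- 1 + r` are both at least `1/2`.
  have h3 : r = (y - 1) * (1 + y) := by linarith
  rw [h2, abs_div, abs_of_pos hy0, div_le_iff₀ hy0, h3, abs_mul, abs_of_pos (by linarith : 0 < 1 + y),
    abs_sub_comm y 1]
  have h4 : 0 ≤ |1 - y| := abs_nonneg _
  have h5 : 1 ≤ (1 + y) * y := by nlinarith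
  nlinarith

/-- The common factor `s / √n` cancels. This permits passing from residuals to normalised residuals.
-/
theorem studentized_eq {n : ℕ} (hn : 0 < n) {s : ℝ} (hs : 0 < s) (x : Fin n → ℝ) :
    ((1 / √(n : ℝ)) * ∑ i, s * x i) /
      √((1 / (n : ℝ)) * (∑ i, (s * x i) ^ 2) - ((1 / (n : ℝ)) * ∑ i, s * x i) ^ 2) =
      (∑ i, x i) / √(∑ i, x i ^ 2 - 1 / n * (∑ i, x i) ^ 2) := by
  have hn' : (0 : ℝ) < n := by exact_mod_cast hn
  have h1 : (1 / (n : ℝ)) * (∑ i, (s * x i) ^ 2) - ((1 / (n : ℝ)) * ∑ i, s * x i) ^ 2 =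
      (s / √n) ^ 2 * (∑ i, x i ^ 2 - 1 / n * (∑ i, x i) ^ 2) := by
    simp only [mul_pow]
    rw [← Finset.mul_sum, ← Finset.mul_sum, div_pow s, Real.sq_sqrt hn'.le]
    field_simp
  rw [h1, Real.sqrt_mul (sq_nonneg _), Real.sqrt_sq (by positivity), ← Finset.mul_sum,
    ← mul_assoc, one_div_mul_eq_div, mul_div_mul_left]
  positivity

set_option maxHeartbeats 1000000 in
/-- The test statistic is close to the oracle statistic when the residuals `u` are negligible, the
regression errors `b` are small and the weighted sum of squared noise variables is close to its
conditional mean `V`. -/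
theorem abs_studentized_sub_le {n : ℕ} {u e b : Fin n → ℝ} {c D K η V : ℝ} (hc : 0 < c)
    (hη1 : η ≤ 1) (hcV : c ≤ V) (hVD : V ≤ D) (v : Fin n → ℝ)
    (hv : ∀ i, v i = u i / √(∑ k, u k ^ 2)) (hv1 : ∑ i, v i ^ 2 = 1)
    (hvη : ∀ i, |v i| ≤ η) (hbη : ∀ i, |b i| ≤ η) (hbv : |∑ i, b i * v i| ≤ η)
    (hV : |∑ i, v i ^ 2 * e i ^ 2 - V| ≤ η) (hS : |∑ i, v i / √V * e i| ≤ K)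
    (hB : η * ((6 + D + 2 * D * K ^ 2) / c) ≤ 1 / 2) :
    |((1 / √(n : ℝ)) * ∑ i, (e i - b i) * u i) /
      √((1 / (n : ℝ)) * (∑ i, ((e i - b i) * u i) ^ 2) -
        ((1 / (n : ℝ)) * ∑ i, (e i - b i) * u i) ^ 2) - ∑ i, v i / √V * e i| ≤
      η * (K * ((6 + D + 2 * D * K ^ 2) / c) + 2 / √c) := by
  set s := √(∑ k, u k ^ 2) with hs
  -- If `s` were `0`, division by zero would make every weight vanish, against `∑ v_i² = 1`.
  have hs0 : s ≠ 0 := by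
    intro h0
    simp [hv, h0] at hv1
  have hspos : 0 < s := lt_of_le_of_ne (Real.sqrt_nonneg _) (Ne.symm hs0)
  have hn : 0 < n := by
    rcases Nat.eq_zero_or_pos n with rfl | h
    · simp at hv1
    · exact h
  have hn' : (0 : ℝ) < n := by exact_mod_cast hn
  have hη0 : 0 ≤ η := (abs_nonneg _).trans hV
  have hK0 : 0 ≤ K := (abs_nonneg _).trans hS
  have hVpos : 0 < V := hc.trans_le hcV
  have hD0 : 0 < D := hVpos.trans_le hVD
  set S := ∑ i, v i / √V * e i with hSdef
  set A := ∑ i, (e i - b i) * v i with hA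
  set β := ∑ i, b i * v i with hβ
  set Q := ∑ i, ((e i - b i) * v i) ^ 2 - 1 / n * A ^ 2 with hQ
  set sV := √V with hsV
  have hsV2 : sV ^ 2 = V := Real.sq_sqrt hVpos.le
  have hsVpos : 0 < sV := Real.sqrt_pos.2 hVpos
  have hAS : A = sV * S - β := by
    rw [hA, hSdef, hβ, Finset.mul_sum, ← Finset.sum_sub_distrib]
    refine Finset.sum_congr rfl fun i _ => ?_
    field_simp
  have hL : ∀ i, (e i - b i) * u i = s * ((e i - b i) * v i) := fun i => by
    rw [hv i]; field_simp
  simp only [hL]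
  rw [studentized_eq hn hspos, ← hA, ← hQ]
  have hA2 : A ^ 2 ≤ 2 * D * K ^ 2 + 2 := by
    have h1 : S ^ 2 ≤ K ^ 2 := sq_le_sq' (abs_le.1 hS).1 (abs_le.1 hS).2
    have h2 : β ^ 2 ≤ 1 := by
      have := sq_le_sq' (abs_le.1 hbv).1 (abs_le.1 hbv).2
      nlinarith
    have h3 : (sV * S) ^ 2 ≤ D * K ^ 2 := by
      rw [mul_pow, hsV2]; gcongr
    rw [hAS]
    nlinarith [sq_nonneg (sV * S + β)]
  -- Negligible weights force a large sample: `1 = ∑ v_i² ≤ n η² ≤ n η`. This disposes of the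
  -- squared empirical mean.
  have hninv : 1 / (n : ℝ) ≤ η := by
    have h1 : (1 : ℝ) ≤ n * η ^ 2 := by
      rw [← hv1]
      calc ∑ i, v i ^ 2 ≤ ∑ _i : Fin n, η ^ 2 := Finset.sum_le_sum fun i _ =>
            sq_le_sq' (abs_le.1 (hvη i)).1 (abs_le.1 (hvη i)).2
        _ = n * η ^ 2 := by simp
    have h2 : n * η ^ 2 ≤ n * η := by
      gcongr
      nlinarith
    rw [div_le_iff₀ hn']
    linarith
  have hcross : |∑ i, ((e i - b i) * v i) ^ 2 - ∑ i, v i ^ 2 * e i ^ 2| ≤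
      η * (1 + D + η) + η ^ 2 := by
    rw [← Finset.sum_sub_distrib]
    have h1 : ∀ i, |((e i - b i) * v i) ^ 2 - v i ^ 2 * e i ^ 2| ≤
        η * (v i ^ 2 + v i ^ 2 * e i ^ 2) + η ^ 2 * v i ^ 2 := by
      intro i
      have h2 : ((e i - b i) * v i) ^ 2 - v i ^ 2 * e i ^ 2 =
          v i ^ 2 * (b i ^ 2 - 2 * e i * b i) := by ring
      have h3 : |b i ^ 2 - 2 * e i * b i| ≤ η * (1 + e i ^ 2) + η ^ 2 := by
        have h4 : |b i| ^ 2 ≤ η ^ 2 := by gcongr; exact hbη i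
        have h5 : 2 * |e i| ≤ 1 + e i ^ 2 := by
          nlinarith [sq_nonneg (|e i| - 1), sq_abs (e i)]
        calc |b i ^ 2 - 2 * e i * b i| ≤ |b i ^ 2| + |2 * e i * b i| := abs_sub _ _
          _ = |b i| ^ 2 + 2 * |e i| * |b i| := by simp [abs_mul]
          _ ≤ η ^ 2 + (1 + e i ^ 2) * η := by gcongr; exact hbη i
          _ = _ := by ring
      rw [h2, abs_mul, abs_of_nonneg (sq_nonneg (v i))]
      calc _ ≤ v i ^ 2 * (η * (1 + e i ^ 2) + η ^ 2) := by gcongr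
        _ = _ := by ring
    refine (Finset.abs_sum_le_sum_abs _ _).trans ((Finset.sum_le_sum fun i _ => h1 i).trans ?_)
    rw [Finset.sum_add_distrib, ← Finset.mul_sum, ← Finset.mul_sum, Finset.sum_add_distrib, hv1,
      mul_one]
    have h6 : 1 + ∑ i, v i ^ 2 * e i ^ 2 ≤ 1 + D + η := by linarith [(abs_le.1 hV).2]
    linarith [mul_le_mul_of_nonneg_left h6 hη0]
  -- Contributions to the constant: `1 + D`, `1` and `1` from the cross terms (using `η² ≤ η`), `1`
  -- from the law of large numbers, and `2 D K² + 2` from the squared mean.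
  have hQV : |Q - V| ≤ η * (6 + D + 2 * D * K ^ 2) := by
    have h1 : 0 ≤ 1 / (n : ℝ) * A ^ 2 := by positivity
    have h2 : 1 / (n : ℝ) * A ^ 2 ≤ η * (2 * D * K ^ 2 + 2) := by gcongr
    have h3 : η ^ 2 ≤ η := by nlinarith
    have h4 := abs_le.1 hcross
    have h5 := abs_le.1 hV
    have h6 : η * (1 + D + η) + η ^ 2 + η + η * (2 * D * K ^ 2 + 2) ≤
        η * (6 + D + 2 * D * K ^ 2) := by linarith
    have h7 : 0 ≤ η * (2 * D * K ^ 2 + 2) := by positivity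
    rw [hQ, abs_le]
    constructor <;> linarith
  set r := (Q - V) / V with hr
  have hrb : |r| ≤ η * ((6 + D + 2 * D * K ^ 2) / c) := by
    rw [hr, abs_div, abs_of_pos hVpos, ← mul_div_assoc]
    gcongr
  obtain ⟨hy1, hy2⟩ := half_le_sqrt_one_add (hrb.trans hB)
  have hQr : √Q = sV * √(1 + r) := by
    rw [hsV, ← Real.sqrt_mul hVpos.le]
    congr 1
    rw [hr]; field_simp; ring
  set y := √(1 + r) with hy
  have hy0 : 0 < y := by linarith
  have hT : A / √Q - S = S * (1 / y - 1) - β / sV * (1 / y) := by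
    rw [hQr, hAS]; field_simp; ring
  have hyinv : 1 / y ≤ 2 := by rw [div_le_iff₀ hy0]; linarith
  have hsc : √c ≤ sV := Real.sqrt_le_sqrt hcV
  have hsc0 : 0 < √c := Real.sqrt_pos.2 hc
  rw [hT]
  calc |S * (1 / y - 1) - β / sV * (1 / y)| ≤ |S * (1 / y - 1)| + |β / sV * (1 / y)| := abs_sub _ _
    _ = |S| * |1 / y - 1| + |β| / sV * (1 / y) := by
      rw [abs_mul, abs_mul, abs_div, abs_of_pos hsVpos, abs_of_pos (by positivity : 0 < 1 / y)]
    _ ≤ K * (η * ((6 + D + 2 * D * K ^ 2) / c)) + η / √c * 2 := by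
      have := hy2.trans hrb
      gcongr
    _ = _ := by ring

/-! ### Quantities determined by the design -/

theorem abs_dotProduct_le_l1Norm {d : ℕ} (x z : Fin d → ℝ) : |x ⬝ᵥ z| ≤ l1Norm x * ‖z‖ := by
  unfold dotProduct l1Norm
  rw [Finset.sum_mul]
  refine (Finset.abs_sum_le_sum_abs _ _).trans (Finset.sum_le_sum fun j _ => ?_)
  rw [abs_mul]
  gcongr
  exact norm_le_pi_norm z j

section Design

variable {n d : ℕ} {𝒳 𝒮 : Type*} [MeasurableSpace 𝒳] [MeasurableSpace 𝒮]

/-- The residuals `u` as functions of the design. -/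
def designResidual (p : PCM n d 𝒳 𝒮)
    (q : (Fin n → 𝒳 × (Fin d → ℝ)) × ((Fin n → Obs 𝒳 d) × 𝒮)) (i : Fin n) : ℝ :=
  p.fhat q.2.1 q.2.2 (q.1 i) -
    p.regF.coef (fun k => p.fhat q.2.1 q.2.2 (q.1 k)) (fun k => (q.1 k).2) q.2.2 ⬝ᵥ (q.1 i).2

/-- The normalised residuals as functions of the design. -/
def designWeight (p : PCM n d 𝒳 𝒮)
    (q : (Fin n → 𝒳 × (Fin d → ℝ)) × ((Fin n → Obs 𝒳 d) × 𝒮)) (i : Fin n) : ℝ :=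
  designResidual p q i / √(∑ k, designResidual p q k ^ 2)

theorem measurable_designResidual (p : PCM n d 𝒳 𝒮) (i : Fin n) :
    Measurable fun q => designResidual p q i := by
  have h1 : ∀ k, Measurable fun q : (Fin n → 𝒳 × (Fin d → ℝ)) × ((Fin n → Obs 𝒳 d) × 𝒮) =>
      p.fhat q.2.1 q.2.2 (q.1 k) := fun k =>
    p.measurable_fhat.comp (g := fun q : ((Fin n → Obs 𝒳 d) × 𝒮) × (𝒳 × (Fin d → ℝ)) =>
      p.fhat q.1.1 q.1.2 q.2) (f := fun q : (Fin n → 𝒳 × (Fin d → ℝ)) × ((Fin n → Obs 𝒳 d) × 𝒮) =>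
      (q.2, q.1 k)) (by fun_prop)
  have h2 : Measurable fun q : (Fin n → 𝒳 × (Fin d → ℝ)) × ((Fin n → Obs 𝒳 d) × 𝒮) =>
      p.regF.coef (fun k => p.fhat q.2.1 q.2.2 (q.1 k)) (fun k => (q.1 k).2) q.2.2 :=
    p.regF.measurable_coef.comp (f := fun q : (Fin n → 𝒳 × (Fin d → ℝ)) ×
      ((Fin n → Obs 𝒳 d) × 𝒮) =>
      ((fun k => p.fhat q.2.1 q.2.2 (q.1 k)), (fun k => (q.1 k).2), q.2.2))
      ((measurable_pi_lambda _ h1).prodMk (by fun_prop))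
  refine (h1 i).sub ?_
  unfold dotProduct
  exact Finset.measurable_fun_sum _ fun j _ => ((measurable_pi_apply j).comp h2).mul (by fun_prop)

@[fun_prop]
theorem measurable_designWeight (p : PCM n d 𝒳 𝒮) (i : Fin n) :
    Measurable fun q => designWeight p q i :=
  (measurable_designResidual p i).div
    (Real.continuous_sqrt.measurable.comp
      (Finset.measurable_fun_sum _ fun k _ => (measurable_designResidual p k).pow_const 2))

/-- The value `0` is the degenerate case of vanishing residuals under `0 / 0 = 0`. The second half
of (b) therefore only makes degeneracy improbable. -/
theorem sum_upsilon_sq (p : PCM n d 𝒳 𝒮) (ω : Sample n 𝒳 d 𝒮) :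
    ∑ i, p.upsilon ω i ^ 2 = 0 ∨ ∑ i, p.upsilon ω i ^ 2 = 1 := by
  have h0 : 0 ≤ ∑ k, p.u ω k ^ 2 := Finset.sum_nonneg fun _ _ => sq_nonneg _
  have h : ∑ i, p.upsilon ω i ^ 2 = (∑ k, p.u ω k ^ 2) / ∑ k, p.u ω k ^ 2 := by
    simp only [PCM.upsilon, div_pow, Real.sq_sqrt h0]
    rw [Finset.sum_div]
  rw [h]
  by_cases h1 : ∑ k, p.u ω k ^ 2 = 0
  · left; simp [h1]
  · right; exact div_self h1

/-- The conditional variance of the noise given `(X, Z)`. -/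
def noiseVariance (P : Measure (Obs 𝒳 d)) [IsFiniteMeasure P] (γ : Fin d → ℝ)
    (a : 𝒳 × (Fin d → ℝ)) : ℝ := ∫ x, x ^ 2 ∂noiseKernel P γ a

@[fun_prop]
theorem measurable_noiseVariance (P : Measure (Obs 𝒳 d)) [IsFiniteMeasure P] (γ : Fin d → ℝ) :
    Measurable (noiseVariance P γ) :=
  (StronglyMeasurable.integral_kernel (κ := noiseKernel P γ) (f := fun x : ℝ => x ^ 2)
    (by fun_prop)).measurable

/-- The conditional variance given the design of the weighted sum of the noise variables. -/
def designVariance (p : PCM n d 𝒳 𝒮) (P : Measure (Obs 𝒳 d)) [IsFiniteMeasure P]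
    (γ : Fin d → ℝ) (q : (Fin n → 𝒳 × (Fin d → ℝ)) × ((Fin n → Obs 𝒳 d) × 𝒮)) : ℝ :=
  ∑ i, designWeight p q i ^ 2 * noiseVariance P γ (q.1 i)

@[fun_prop]
theorem measurable_designVariance (p : PCM n d 𝒳 𝒮) (P : Measure (Obs 𝒳 d)) [IsFiniteMeasure P]
    (γ : Fin d → ℝ) : Measurable (designVariance p P γ) := by
  unfold designVariance
  exact Finset.measurable_fun_sum _ fun i _ =>
    ((measurable_designWeight p i).pow_const 2).mul (by fun_prop)

theorem designVariance_mem (p : PCM n d 𝒳 𝒮) (P : Measure (Obs 𝒳 d)) [IsFiniteMeasure P]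
    {γ : Fin d → ℝ} {δ c C : ℝ} (hδ : 0 ≤ δ)
    {q : (Fin n → 𝒳 × (Fin d → ℝ)) × ((Fin n → Obs 𝒳 d) × 𝒮)}
    (h : ∀ i, IsErrorLaw (noiseKernel P γ (q.1 i)) δ c C) (h1 : ∑ i, designWeight p q i ^ 2 = 1) :
    c ≤ designVariance p P γ q ∧ designVariance p P γ q ≤ 1 + C := by
  unfold designVariance noiseVariance
  constructor
  · calc c = ∑ i, designWeight p q i ^ 2 * c := by rw [← Finset.sum_mul, h1, one_mul]
      _ ≤ _ := Finset.sum_le_sum fun i _ =>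
        mul_le_mul_of_nonneg_left (h i).le_variance (sq_nonneg _)
  · calc _ ≤ ∑ i, designWeight p q i ^ 2 * (1 + C) := Finset.sum_le_sum fun i _ =>
        mul_le_mul_of_nonneg_left ((h i).variance_le hδ) (sq_nonneg _)
      _ = 1 + C := by rw [← Finset.sum_mul, h1, one_mul]

/-- The oracle statistic, in which noise variables replace the residuals of the regression of `Y`
on `Z` and the conditional variance replaces its estimate. -/
def oracleStat (p : PCM n d 𝒳 𝒮) (P : Measure (Obs 𝒳 d)) [IsFiniteMeasure P]
    (γ : Fin d → ℝ) (ω : Sample n 𝒳 d 𝒮) : ℝ :=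
  ∑ i, p.upsilon ω i / √(designVariance p P γ (design ω)) * noise γ (ω.1 i)

theorem measurable_oracleStat (p : PCM n d 𝒳 𝒮) (P : Measure (Obs 𝒳 d)) [IsFiniteMeasure P]
    (γ : Fin d → ℝ) : Measurable (oracleStat p P γ) := by
  have hd : Measurable (design : Sample n 𝒳 d 𝒮 → _) := by unfold design; fun_prop
  refine Finset.measurable_fun_sum _ fun i _ => Measurable.mul (Measurable.div ?_ ?_)
    ((measurable_noise γ).comp (by fun_prop))
  · exact (measurable_designWeight p i).comp hd
  · exact Real.continuous_sqrt.measurable.comp ((measurable_designVariance p P γ).comp hd)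

/-- The event that the normalised residuals are well-defined and at most `m`. -/
def negligibleSet (p : PCM n d 𝒳 𝒮) (m : ℝ) :
    Set ((Fin n → 𝒳 × (Fin d → ℝ)) × ((Fin n → Obs 𝒳 d) × 𝒮)) :=
  {q | (∀ i, |designWeight p q i| ≤ m) ∧ ∑ i, designWeight p q i ^ 2 = 1}

theorem measurableSet_negligibleSet (p : PCM n d 𝒳 𝒮) (m : ℝ) :
    MeasurableSet (negligibleSet p m) := by
  refine MeasurableSet.inter ?_ ?_
  · have h : {q | ∀ i, |designWeight p q i| ≤ m} = ⋂ i, {q | |designWeight p q i| ≤ m} := by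
      ext; simp
    change MeasurableSet {q | ∀ i, |designWeight p q i| ≤ m}
    rw [h]
    exact MeasurableSet.iInter fun i =>
      measurableSet_le (measurable_designWeight p i).abs measurable_const
  · exact measurableSet_eq_fun (Finset.measurable_fun_sum _ fun i _ =>
      (measurable_designWeight p i).pow_const 2) measurable_const

/-- Since the sum of squares is `0` or `1`, a distance of at most `1/2` from `1` already means
equality. -/
theorem sampleLaw_real_compl_negligibleSet_le (p : PCM n d 𝒳 𝒮) (m : ℝ)
    (P : ProbabilityMeasure (Obs 𝒳 d)) (ρ : Measure 𝒮) [IsProbabilityMeasure ρ] :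
    (sampleLaw n P ρ).real {ω | design ω ∉ negligibleSet p m} ≤
      (sampleLaw n P ρ).real {ω | m < |(⨆ i, |p.upsilon ω i|)|} +
      (sampleLaw n P ρ).real {ω | 1 / 2 < |(∑ i, p.upsilon ω i ^ 2) - 1|} := by
  refine (measureReal_mono ?_).trans (measureReal_union_le _ _)
  intro ω hω
  by_contra hcon
  simp only [Set.mem_union, Set.mem_ofPred_eq, not_or, not_lt] at hcon
  refine hω ⟨fun i => ?_, ?_⟩
  · exact (le_ciSup (f := fun i => |p.upsilon ω i|) (Set.finite_range _).bddAbove i).trans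
      ((le_abs_self _).trans hcon.1)
  · rcases sum_upsilon_sq p ω with h | h
    · rw [h] at hcon; norm_num at hcon
    · exact h

theorem ae_forall_isErrorLaw (P : ProbabilityMeasure (Obs 𝒳 d)) (ρ : Measure 𝒮)
    [IsProbabilityMeasure ρ] {γ : Fin d → ℝ} {δ c C : ℝ} (hδ : 0 ≤ δ)
    (hnull : NullLinearModel (P : Measure (Obs 𝒳 d)) γ)
    (hmom : NoiseMoments (P : Measure (Obs 𝒳 d)) γ δ c C) :
    ∀ᵐ ω ∂sampleLaw n P ρ,
      ∀ i, IsErrorLaw (noiseKernel (P : Measure (Obs 𝒳 d)) γ (covariates (ω.1 i))) δ c C := by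
  rw [ae_all_iff]
  intro i
  have h1 := ae_of_ae_map measurable_covariates.aemeasurable
    (ae_isErrorLaw_noiseKernel (P : Measure (Obs 𝒳 d)) hδ hnull hmom)
  exact Measure.quasiMeasurePreserving_fst.ae ((Measure.quasiMeasurePreserving_eval
    (fun _ : Fin n => (P : Measure (Obs 𝒳 d))) i).ae h1)

end Design

/-! ### The two limit results, integrated over the design -/

theorem exists_forall_abs_oracleStat_cdf_sub_le {δ c C ε : ℝ} (hδ : 0 < δ) (hc : 0 < c)
    (hC : 0 ≤ C) (hε : 0 < ε) :
    ∃ m₀ : ℝ, 0 < m₀ ∧ ∀ {n d : ℕ} {𝒳 𝒮 : Type*} [MeasurableSpace 𝒳] [MeasurableSpace 𝒮]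
      (p : PCM n d 𝒳 𝒮) (P : ProbabilityMeasure (Obs 𝒳 d)) (ρ : Measure 𝒮)
      [IsProbabilityMeasure ρ] (γ : Fin d → ℝ), NullLinearModel (P : Measure (Obs 𝒳 d)) γ →
      NoiseMoments (P : Measure (Obs 𝒳 d)) γ δ c C → ∀ m ≤ m₀, ∀ t : ℝ,
      |(sampleLaw n P ρ).real {ω | oracleStat p (P : Measure (Obs 𝒳 d)) γ ω ≤ t} -
        cdf (gaussianReal 0 1) t| ≤
        ε + (sampleLaw n P ρ).real {ω | design ω ∉ negligibleSet p m} := by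
  obtain ⟨m₁, hm₁, hclt⟩ := exists_forall_abs_measureReal_weighted_sum_le_sub_cdf_le
    (δ := min δ 1) (C := 1 + C) (lt_min hδ one_pos) (min_le_right _ _) hc (by linarith) hε
  -- The weights of the central limit theorem are `υ_i / √V` with `V ≥ c`, hence at most `m₁` when
  -- `|υ_i| ≤ m₁ √c`.
  refine ⟨m₁ * √c, by positivity, ?_⟩
  intro n d 𝒳 𝒮 _ _ p P ρ _ γ hnull hmom m hm t
  have hE : MeasurableSet {x : ((Fin n → 𝒳 × (Fin d → ℝ)) × (Fin n → ℝ)) ×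
      ((Fin n → Obs 𝒳 d) × 𝒮) |
      ∑ i, designWeight p (x.1.1, x.2) i /
        √(designVariance p (P : Measure (Obs 𝒳 d)) γ (x.1.1, x.2)) * x.1.2 i ≤ t} := by
    refine measurableSet_le (Finset.measurable_fun_sum _ fun i _ => ?_) measurable_const
    refine Measurable.mul (Measurable.div ?_ ?_) (by fun_prop)
    · exact (measurable_designWeight p i).comp (by fun_prop)
    · exact Real.continuous_sqrt.measurable.comp
        ((measurable_designVariance p _ γ).comp (by fun_prop))
  refine abs_sampleLaw_real_sub_le P ρ hδ.le hnull hmom (measurableSet_negligibleSet p m) hE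
    (cdf_nonneg _ _) (cdf_le_one _ _) hε.le fun a θ ha hG => ?_
  obtain ⟨hv, hv1⟩ := hG
  have hV := (designVariance_mem p (P : Measure (Obs 𝒳 d)) (q := (a, θ)) hδ.le ha hv1).1
  have hVpos := hc.trans_le hV
  refine hclt n _ inferInstance
    (fun i => (ha i).mono_exponent (le_min hδ.le zero_le_one) (min_le_left _ _))
    (fun i => designWeight p (a, θ) i / √(designVariance p (P : Measure (Obs 𝒳 d)) γ (a, θ)))
    (fun i => ?_) ?_ t
  · rw [abs_div, abs_of_nonneg (Real.sqrt_nonneg _), div_le_iff₀ (Real.sqrt_pos.2 hVpos)]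
    refine (hv i).trans (hm.trans ?_)
    gcongr
  · simp only [div_pow, Real.sq_sqrt hVpos.le, div_mul_eq_mul_div]
    rw [← Finset.sum_div]
    exact div_self hVpos.ne'

theorem exists_forall_sum_upsilon_sq_mul_noise_sq_le {δ c C η ε : ℝ} (hδ : 0 < δ) (hδ2 : δ ≤ 2)
    (hc : 0 ≤ c) (hC : 0 ≤ C) (hη : 0 < η) (hε : 0 < ε) :
    ∃ m₀ : ℝ, 0 < m₀ ∧ ∀ {n d : ℕ} {𝒳 𝒮 : Type*} [MeasurableSpace 𝒳] [MeasurableSpace 𝒮]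
      (p : PCM n d 𝒳 𝒮) (P : ProbabilityMeasure (Obs 𝒳 d)) (ρ : Measure 𝒮)
      [IsProbabilityMeasure ρ] (γ : Fin d → ℝ), NullLinearModel (P : Measure (Obs 𝒳 d)) γ →
      NoiseMoments (P : Measure (Obs 𝒳 d)) γ δ c C → ∀ m ≤ m₀,
      (sampleLaw n P ρ).real {ω | η < |∑ i, p.upsilon ω i ^ 2 * noise γ (ω.1 i) ^ 2 -
        designVariance p (P : Measure (Obs 𝒳 d)) γ (design ω)|} ≤
        ε + (sampleLaw n P ρ).real {ω | design ω ∉ negligibleSet p m} := by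
  obtain ⟨m₀, hm₀, hlln⟩ := exists_forall_measureReal_weighted_sum_sq_le hδ hδ2 hc hC hη hε
  refine ⟨m₀, hm₀, ?_⟩
  intro n d 𝒳 𝒮 _ _ p P ρ _ γ hnull hmom m hm
  have hE : MeasurableSet {x : ((Fin n → 𝒳 × (Fin d → ℝ)) × (Fin n → ℝ)) ×
      ((Fin n → Obs 𝒳 d) × 𝒮) |
      η < |∑ i, designWeight p (x.1.1, x.2) i ^ 2 * x.1.2 i ^ 2 -
        designVariance p (P : Measure (Obs 𝒳 d)) γ (x.1.1, x.2)|} := by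
    refine measurableSet_lt measurable_const (Measurable.abs (Measurable.sub
      (Finset.measurable_fun_sum _ fun i _ => Measurable.mul (Measurable.pow_const ?_ 2)
        (by fun_prop)) ?_))
    · exact (measurable_designWeight p i).comp (by fun_prop)
    · exact (measurable_designVariance p _ γ).comp (by fun_prop)
  -- The target probability is `q = 0`.
  have h1 := abs_sampleLaw_real_sub_le (n := n) P ρ hδ.le hnull hmom
    (measurableSet_negligibleSet p m) hE le_rfl zero_le_one hε.le fun a θ ha hG => by
      rw [sub_zero, abs_of_nonneg measureReal_nonneg]
      refine (le_of_eq ?_).trans (hlln n _ inferInstance ha (fun i => designWeight p (a, θ) i)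
        (fun i => (hG.1 i).trans hm) hG.2)
      simp only [mul_sub, Finset.sum_sub_distrib]
      rfl
  rw [sub_zero, abs_of_nonneg measureReal_nonneg] at h1
  exact h1


/-! ### From the oracle statistic to the test statistic -/

section Statistic

variable {n d : ℕ} {𝒳 𝒮 : Type*} [MeasurableSpace 𝒳] [MeasurableSpace 𝒮]

/-- On the event that all nuisance terms are small, the statistic is close to the oracle one. -/
theorem abs_T_sub_oracleStat_le (p : PCM n d 𝒳 𝒮) (P : Measure (Obs 𝒳 d)) [IsFiniteMeasure P]
    {γ : Fin d → ℝ} {δ c C K η m : ℝ} (hδ : 0 ≤ δ) (hc : 0 < c) (hη1 : η ≤ 1)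
    (hmη : m ≤ η) (hB : η * ((6 + (1 + C) + 2 * (1 + C) * K ^ 2) / c) ≤ 1 / 2)
    (ω : Sample n 𝒳 d 𝒮) (herr : ∀ i, IsErrorLaw (noiseKernel P γ (covariates (ω.1 i))) δ c C)
    (hG : design ω ∈ negligibleSet p m)
    (hV : |∑ i, p.upsilon ω i ^ 2 * noise γ (ω.1 i) ^ 2 - designVariance p P γ (design ω)| ≤ η)
    (hS : |oracleStat p P γ ω| ≤ K)
    (hfit : |(⨆ i, ‖ω.Z i‖) * l1Norm (p.gammaHat ω - γ)| ≤ η)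
    (hbias : |l1Norm (p.gammaHat ω - γ) * ‖∑ i, p.upsilon ω i • ω.Z i‖| ≤ η) :
    |p.T ω - oracleStat p P γ ω| ≤
      η * (K * ((6 + (1 + C) + 2 * (1 + C) * K ^ 2) / c) + 2 / √c) := by
  obtain ⟨hv, hv1⟩ := hG
  obtain ⟨hV1, hV2⟩ := designVariance_mem p P (q := design ω) hδ herr hv1
  have hl : 0 ≤ l1Norm (p.gammaHat ω - γ) := Finset.sum_nonneg fun _ _ => abs_nonneg _
  have hL : ∀ i, p.L ω i =
      (noise γ (ω.1 i) - (p.gammaHat ω - γ) ⬝ᵥ ω.Z i) * p.u ω i := fun i => by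
    unfold PCM.L noise
    rw [sub_dotProduct]
    simp only [Sample.Y, Sample.Z]
    ring
  have h := abs_studentized_sub_le (u := p.u ω) (e := fun i => noise γ (ω.1 i))
    (b := fun i => (p.gammaHat ω - γ) ⬝ᵥ ω.Z i) (V := designVariance p P γ (design ω))
    hc hη1 hV1 hV2 (p.upsilon ω) (fun i => rfl) hv1 (fun i => (hv i).trans hmη) (fun i => ?_)
    ?_ hV hS hB
  · simp only [← hL] at h
    exact h
  · refine (abs_dotProduct_le_l1Norm _ _).trans (le_trans ?_ ((le_abs_self _).trans hfit))
    rw [mul_comm]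
    gcongr
    exact le_ciSup (f := fun i => ‖ω.Z i‖) (Set.finite_range _).bddAbove i
  · have h1 : ∑ i, (p.gammaHat ω - γ) ⬝ᵥ ω.Z i * p.upsilon ω i =
        (p.gammaHat ω - γ) ⬝ᵥ ∑ i, p.upsilon ω i • ω.Z i := by
      rw [dotProduct_sum]
      exact Finset.sum_congr rfl fun i _ => by rw [dotProduct_smul, smul_eq_mul, mul_comm]
    rw [h1]
    exact (abs_dotProduct_le_l1Norm _ _).trans ((le_abs_self _).trans hbias)

end Statistic

/-- Off the bad set, `{T ≤ t}` lies between `{S ≤ t - τ}` and `{S ≤ t + τ}`. Only monotonicity and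
subadditivity enter, so neither `T` nor the bad set has to be measurable. -/
theorem abs_measureReal_le_sub_cdf_le {Ω : Type*} [MeasurableSpace Ω] (μ : Measure Ω)
    [IsProbabilityMeasure μ] {T S : Ω → ℝ} {bad : Set Ω} {τ a b : ℝ} (hτ : 0 ≤ τ)
    (hTS : ∀ ω, ω ∉ bad → |T ω - S ω| ≤ τ) (hbad : μ.real bad ≤ a)
    (hS : ∀ t, |μ.real {ω | S ω ≤ t} - cdf (gaussianReal 0 1) t| ≤ b) (t : ℝ) :
    |μ.real {ω | T ω ≤ t} - cdf (gaussianReal 0 1) t| ≤ τ + a + b := by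
  have h1 : μ.real {ω | T ω ≤ t} ≤ μ.real {ω | S ω ≤ t + τ} + μ.real bad := by
    refine (measureReal_mono fun ω hω => ?_).trans (measureReal_union_le _ _)
    by_cases hb : ω ∈ bad
    · exact Or.inr hb
    · left
      have := (abs_le.1 (hTS ω hb)).1
      simp only [Set.mem_ofPred_eq] at hω ⊢
      linarith
  have h2 : μ.real {ω | S ω ≤ t - τ} ≤ μ.real {ω | T ω ≤ t} + μ.real bad := by
    refine (measureReal_mono fun ω hω => ?_).trans (measureReal_union_le _ _)
    by_cases hb : ω ∈ bad
    · exact Or.inr hb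
    · left
      have := (abs_le.1 (hTS ω hb)).2
      simp only [Set.mem_ofPred_eq] at hω ⊢
      linarith
  have h3 := abs_le.1 (hS (t + τ))
  have h4 := abs_le.1 (hS (t - τ))
  have h5 := cdf_gaussianReal_add_le t hτ
  have h6 := cdf_gaussianReal_add_le (t - τ) hτ
  rw [sub_add_cancel] at h6
  rw [abs_le]
  constructor <;> linarith

/-- Tightness of the oracle statistic, inherited from the Gaussian tails; it supplies the bound `K`
required by the deterministic comparison. -/
theorem measureReal_lt_abs_le {Ω : Type*} [MeasurableSpace Ω] (μ : Measure Ω)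
    [IsProbabilityMeasure μ] {S : Ω → ℝ} {K a b : ℝ}
    (hS : ∀ t, |μ.real {ω | S ω ≤ t} - cdf (gaussianReal 0 1) t| ≤ b)
    (hSm : MeasurableSet {ω | S ω ≤ K})
    (hK : 1 - cdf (gaussianReal 0 1) K ≤ a) (hK' : cdf (gaussianReal 0 1) (-K) ≤ a) :
    μ.real {ω | K < |S ω|} ≤ 2 * a + 2 * b := by
  have h1 : μ.real {ω | K < |S ω|} ≤ μ.real {ω | S ω ≤ -K} + μ.real {ω | S ω ≤ K}ᶜ := by
    refine (measureReal_mono fun ω hω => ?_).trans (measureReal_union_le _ _)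
    rcases lt_abs.1 (show K < |S ω| from hω) with h | h
    · exact Or.inr (not_le.2 h)
    · left
      simp only [Set.mem_ofPred_eq]
      linarith
  rw [probReal_compl_eq_one_sub hSm] at h1
  have h3 := abs_le.1 (hS K)
  have h4 := abs_le.1 (hS (-K))
  linarith

theorem UniformLittleO.eventually_measureReal_le {I : ℕ → Type*} {Ω : ℕ → Type*}
    [∀ n, MeasurableSpace (Ω n)] {𝒬 : ∀ n, Set (I n)} {μ : ∀ n, I n → Measure (Ω n)}
    {R : ∀ n, I n → Ω n → ℝ} (h : UniformLittleO 𝒬 μ R) {η ε : ℝ} (hη : 0 < η) (hε : 0 < ε) :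
    ∀ᶠ n in atTop, ∀ P ∈ 𝒬 n, (μ n P).real {ω | η < |R n P ω|} ≤ ε := by
  filter_upwards [(ENNReal.tendsto_nhds_zero.1 (h η hη)) (ENNReal.ofReal ε) (by simpa using hε)]
    with n hn P hP
  exact ENNReal.toReal_le_of_le_ofReal hε.le
    ((le_iSup₂ (f := fun P (_ : P ∈ 𝒬 n) => μ n P {ω | η < |R n P ω|}) P hP).trans hn)

theorem exists_cdf_gaussianReal_tails {ε : ℝ} (hε : 0 < ε) :
    ∃ K : ℝ, 0 ≤ K ∧ 1 - cdf (gaussianReal 0 1) K ≤ ε ∧ cdf (gaussianReal 0 1) (-K) ≤ ε := by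
  have h1 := (tendsto_cdf_atTop (gaussianReal 0 1)).eventually
    (lt_mem_nhds (show 1 - ε < 1 by linarith))
  have h2 := ((tendsto_cdf_atBot (gaussianReal 0 1)).comp tendsto_neg_atTop_atBot).eventually
    (gt_mem_nhds hε)
  obtain ⟨K, h3, h4, h5⟩ := (h1.and (h2.and (eventually_ge_atTop 0))).exists
  exact ⟨K, h5, by linarith, h4.le⟩

end

theorem mainTheorem7
    -- dimension of `Z`, space of `X`, space and law of the seed: all may depend on `n`
    (d : ℕ → ℕ)
    (𝒳 : ℕ → Type*) [∀ n, MeasurableSpace (𝒳 n)]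
    (𝒮 : ℕ → Type*) [∀ n, MeasurableSpace (𝒮 n)]
    (ρ : ∀ n, Measure (𝒮 n)) [∀ n, IsProbabilityMeasure (ρ n)]
    (p : ∀ n, PCM n (d n) (𝒳 n) (𝒮 n))
    -- the null classes and the regression coefficients
    (𝒬 : ∀ n, Set (ProbabilityMeasure (Obs (𝒳 n) (d n))))
    (γ : ∀ n, ProbabilityMeasure (Obs (𝒳 n) (d n)) → Fin (d n) → ℝ)
    (hnull : ∀ n, ∀ P ∈ 𝒬 n, NullLinearModel (P : Measure (Obs (𝒳 n) (d n))) (γ n P))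
    -- conditional moments of the errors
    (ha : ∃ δ c C : ℝ, 0 < δ ∧ δ ≤ 2 ∧ 0 < c ∧ 0 < C ∧
      ∀ n, ∀ P ∈ 𝒬 n, NoiseMoments (P : Measure (Obs (𝒳 n) (d n))) (γ n P) δ c C)
    -- normalised residuals are uniformly negligible and asymptotically non-degenerate
    (hb₁ : UniformLittleO 𝒬 (fun n P => sampleLaw n P (ρ n))
      (fun n _ ω => ⨆ i, |(p n).upsilon ω i|))
    (hb₂ : UniformLittleO 𝒬 (fun n P => sampleLaw n P (ρ n))
      (fun n _ ω => (∑ i, (p n).upsilon ω i ^ 2) - 1))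
    -- uniform error of the fit of `Y` on `Z`
    (hc : UniformLittleO 𝒬 (fun n P => sampleLaw n P (ρ n))
      (fun n P ω => (⨆ i, ‖ω.Z i‖) * l1Norm ((p n).gammaHat ω - γ n P)))
    -- the bias condition
    (hbias : UniformLittleO 𝒬 (fun n P => sampleLaw n P (ρ n))
      (fun n P ω => l1Norm ((p n).gammaHat ω - γ n P) *
        ‖∑ i, (p n).upsilon ω i • ω.Z i‖)) :
    Tendsto (fun n => ⨆ P ∈ 𝒬 n, ⨆ t : ℝ, ENNReal.ofReal
        |(sampleLaw n P (ρ n)).real {ω | (p n).T ω ≤ t} - cdf (gaussianReal 0 1) t|)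
      atTop (𝓝 0) := by

  have hfit := hc
  clear hc
  obtain ⟨δ, c, C, hδ, hδ2, hc, hC, hmom⟩ := ha
  rw [ENNReal.tendsto_nhds_zero]
  intro ε' hε'
  -- The final budget is `ε` for the distance between the statistics, `15 ε` for the bad event and
  -- `3 ε` for the oracle, in total `19 ε`.
  obtain ⟨ε, hε, hεε'⟩ : ∃ ε : ℝ, 0 < ε ∧ ENNReal.ofReal (20 * ε) ≤ ε' := by
    obtain ⟨r, hr0, hr⟩ := ENNReal.lt_iff_exists_real_btwn.1 hε'
    have hr1 : 0 < r := by simpa using hr.1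
    exact ⟨r / 20, by linarith, by rw [mul_div_cancel₀ _ (by norm_num)]; exact hr.2.le⟩
  obtain ⟨K, hK0, hK1, hK2⟩ := exists_cdf_gaussianReal_tails hε
  obtain ⟨m₁, hm₁, hclt⟩ := exists_forall_abs_oracleStat_cdf_sub_le hδ hc hC.le hε
  set B : ℝ := (6 + (1 + C) + 2 * (1 + C) * K ^ 2) / c with hBdef
  have hB0 : 0 ≤ B := by positivity
  have hsc : 0 < √c := Real.sqrt_pos.2 hc
  have hlim : ∀ a b : ℝ, 0 < b → ∀ᶠ η : ℝ in 𝓝[>] 0, η * a ≤ b := fun a b hb => by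
    have h1 : Tendsto (fun η : ℝ => η * a) (𝓝 0) (𝓝 (0 * a)) := tendsto_id.mul_const a
    rw [zero_mul] at h1
    exact (h1.mono_left nhdsWithin_le_nhds).eventually (ge_mem_nhds hb)
  -- The order of choice matters: `K` depends on `ε`, `B` on `K`, `η` on both, and the threshold `m`
  -- on `η`; all precede `n` and `P`.
  obtain ⟨η, ⟨hη1, hηB, hητ⟩, hη0⟩ := ((hlim 1 1 one_pos).and ((hlim B (1 / 2) (by norm_num)).and
    (hlim (K * B + 2 / √c) ε hε))).and self_mem_nhdsWithin |>.exists
  rw [mul_one] at hη1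
  obtain ⟨m₂, hm₂, hlln⟩ := exists_forall_sum_upsilon_sq_mul_noise_sq_le hδ hδ2 hc.le hC.le hη0 hε
  set m : ℝ := min η (min m₁ m₂) with hm
  have hm0 : 0 < m := lt_min hη0 (lt_min hm₁ hm₂)
  filter_upwards [hb₁.eventually_measureReal_le hm0 hε,
    hb₂.eventually_measureReal_le (show (0 : ℝ) < 1 / 2 by norm_num) hε,
    hfit.eventually_measureReal_le hη0 hε, hbias.eventually_measureReal_le hη0 hε]
    with n h1 h2 h3 h4
  refine iSup₂_le fun P hP => iSup_le fun t => le_trans (ENNReal.ofReal_le_ofReal ?_) hεε'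
  have hG := (sampleLaw_real_compl_negligibleSet_le (p n) m P (ρ n)).trans
    (add_le_add (h1 P hP) (h2 P hP))
  have hS : ∀ s, |(sampleLaw n P (ρ n)).real {ω | oracleStat (p n) (P : Measure _) (γ n P) ω ≤ s} -
      cdf (gaussianReal 0 1) s| ≤ 3 * ε := fun s =>
    (hclt (p n) P (ρ n) (γ n P) (hnull n P hP) (hmom n P hP) m
      ((min_le_right _ _).trans (min_le_left _ _)) s).trans (by linarith)
  have hV := (hlln (p n) P (ρ n) (γ n P) (hnull n P hP) (hmom n P hP) m
      ((min_le_right _ _).trans (min_le_right _ _))).trans (add_le_add le_rfl hG)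
  have hSK := measureReal_lt_abs_le (sampleLaw n P (ρ n)) hS
    (measurableSet_le (measurable_oracleStat (p n) _ _) measurable_const) hK1 hK2
  have herr := ae_forall_isErrorLaw (n := n) P (ρ n) hδ.le (hnull n P hP) (hmom n P hP)
  set μ := sampleLaw n P (ρ n)
  -- The six events cost `0` (conditional laws), `2 ε` (negligibility), `3 ε` (squared errors), `2 ε
  -- + 2 · 3 ε` (tightness), and `ε` each for the fit and the bias.
  have hbadsum : μ.real (
      {ω | ¬ ∀ i, IsErrorLaw (noiseKernel (P : Measure (Obs (𝒳 n) (d n))) (γ n P)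
        (covariates (ω.1 i))) δ c C} ∪
      ({ω | design ω ∉ negligibleSet (p n) m} ∪
      ({ω | η < |∑ i, (p n).upsilon ω i ^ 2 * noise (γ n P) (ω.1 i) ^ 2 -
        designVariance (p n) (P : Measure _) (γ n P) (design ω)|} ∪
      ({ω | K < |oracleStat (p n) (P : Measure _) (γ n P) ω|} ∪
      ({ω | η < |(⨆ i, ‖ω.Z i‖) * l1Norm ((p n).gammaHat ω - γ n P)|} ∪
      {ω | η < |l1Norm ((p n).gammaHat ω - γ n P) *
        ‖∑ i, (p n).upsilon ω i • ω.Z i‖|}))))) ≤ 15 * ε := by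
    have h0 : μ.real {ω | ¬ ∀ i, IsErrorLaw (noiseKernel (P : Measure (Obs (𝒳 n) (d n))) (γ n P)
        (covariates (ω.1 i))) δ c C} = 0 := by
      rw [measureReal_def, ae_iff.1 herr, ENNReal.toReal_zero]
    refine (measureReal_union_le _ _).trans ?_
    rw [h0, zero_add]
    refine (measureReal_union_le _ _).trans ((add_le_add hG
      ((measureReal_union_le _ _).trans (add_le_add hV ((measureReal_union_le _ _).trans
      (add_le_add hSK ((measureReal_union_le _ _).trans
      (add_le_add (h3 P hP) (h4 P hP)))))))).trans ?_)
    linarith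
  refine (abs_measureReal_le_sub_cdf_le μ hε.le (fun ω hω => ?_) hbadsum hS t).trans (by linarith)
  simp only [Set.mem_union, Set.mem_ofPred_eq, not_or, not_not, not_lt] at hω
  obtain ⟨g1, g2, g3, g4, g5, g6⟩ := hω
  exact (abs_T_sub_oracleStat_le (p n) _ hδ.le hc hη1 (min_le_left _ _) hηB ω g1 g2 g3 g4 g5
    g6).trans hητ
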